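/- Consider a game in normal form with a finite non-empty set $A$ of players, finite non-empty strategy sets $S^i$, and payoffs $G^i:S=\prod_{j\in A}S^j\to\mathbb R$. Extend each $G^i$ multilinearly to mixed profiles $\pi\in\Delta=\prod_{i}\Delta^i$, where $\Delta^i$ is the simplex over $S^i$, and write $G^i(s,\pi^{-i})$ when player $i$ plays $s\in S^i$ and the others play $\pi$. Let $X=\prod_{i}\mathbb R^{S^i}$. For parameters $\beta_i>0$ let $\sigma:X\to\Delta$ be the Logit rule $$\sigma^{is}(x^i)=\frac{\exp(\beta_i x^{is})}{\sum_{r\in S^i}\exp(\beta_i x^{ir})}.$$ Let $\eta$ be the maximum of $|G^i(s,r_1)-G^i(s,r_2)|$ over all $i\in A$, $s\in S^i$ and all $r_1,r_2\in\prod_{j\ne i}S^j$ that differ in exactly one coordinate ($\eta=0$ if there are none), and let $\alpha=\max_{i\in A}\sum_{j\neq i}\beta_j$. For $x \in X$ and $\lambda\in\Delta$ with positive coordinates put $$\Phi^{is}(x)=\sigma^{is}(x^i)\big(G^i(s,\sigma^{-i}(x))-x^{is}\big),$$ $$\Psi_x^{is}(x,\lambda)=\frac{\sigma^{is}(x^i)}{\lambda^{is}}\big(G^i(s,\sigma^{-i}(x))-x^{is}\big),\qquad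 \Psi_\lambda^{is}(x,\lambda)=\sigma^{is}(x^i)-\lambda^{is}.$$ For a real square matrix $B$ let $\rho(B)$ be the maximal real part of its complex eigenvalues, and let $\nabla\Phi$ denote the Jacobian matrix of $\Phi$. The game is repeated at stages $n=1,2,\dots$. At stage $n+1$ a profile $s_{n+1}\in S$ is drawn: conditionally on the $\sigma$-algebra $\mathcal F_n$ generated by the profiles and payoffs of stages $1,\dots,n$, the players draw independently, player $i$ choosing $s\in S^i$ with probability $\sigma^{is}(x_n^i)$. Player $i$ receives $g^i_{n+1}=G^i(s_{n+1})$. The perceptions $x_n\in X$, with deterministic $x_0\in X$, are updated only in the coordinates played: $x_{n+1}^{is}=x_n^{is}$ if $s\ne s^i_{n+1}$, and if $s=s^i_{n+1}$ then - for the process of Cominetti et al., $$x_{n+1}^{is}=\Big(1-\frac1{n+1}\Big)x_n^{is}+\frac1{n+1}\,g^i_{n+1};$$ - for the adjusted process, $$x_{n+1}^{is}=\Big(1-\frac1{\theta_n^{is}}\Big)x_n^{is}+\frac1{\theta_n^{is}}\,g^i_{n+1},$$ where $\theta_n^{is}=\theta_0^{is}+\#\{1\le m\le n: s_m^i=s\}$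 with deterministic $\theta_0^{is}>0$; here we also set $\lambda_n^{is}=\theta_n^{is}/(n+1)$. **Proposition.** Assume $2\eta\alpha<1$. Then $\Phi$ has a unique zero $x_*\in X$, and $(\Psi_x,\Psi_\lambda)$ has a unique zero in $X\times\Delta$, which is of the form $(x_*,\lambda_*)$ with the same $x_*$. Moreover: (i) for the process of Cominetti et al., almost surely, $n^\delta(x_n-x_*)\to0$ as $n\to\infty$ for every $\delta\in(0,|\rho(\nabla\Phi(x_*))|)$; (ii) for the adjusted process, almost surely, $n^\delta\big((x_n,\lambda_n)-(x_*,\lambda_*)\big)\to0$ as $n\to\infty$ for every $\delta\in(0,1/2)$. -/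

import Mathlib

open MeasureTheory Filter Topology

noncomputable section

namespace LearningGame

/-- Pure strategy profiles `∏ i, S i`. -/
abbrev Profile {A : Type*} (S : A → Type*) : Type _ := (i : A) → S i

/-- The space `∏ i, ℝ^{S i}`; it carries both perception profiles and mixed profiles. -/
abbrev State {A : Type*} (S : A → Type*) : Type _ := (i : A) → S i → ℝ

/-- The set of mixed strategy profiles, the product of the simplices over the `S i`. -/
def mixed {A : Type*} (S : A → Type*) [∀ i, Fintype (S i)] : Set (State S) :=
  {p | ∀ i, p i ∈ stdSimplex ℝ (S i)}

variable {A : Type*} [Fintype A] [DecidableEq A] {S : A → Type*} [∀ i, Fintype (S i)]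
  [∀ i, DecidableEq (S i)]

/-- The multilinear extension of the payoff function of player `i`. -/
def payoff (G : A → Profile S → ℝ) (i : A) (p : State S) : ℝ :=
  ∑ a : Profile S, G i a * ∏ j, p j (a j)

/-- `G^i(r, p^{-i})`: player `i` plays the pure strategy `r`, the others play according to `p`. -/
def payoffAgainst (G : A → Profile S → ℝ) (i : A) (r : S i) (p : State S) : ℝ :=
  payoff G i (Function.update p i (Pi.single r 1))

/-- The Logit decision rule with smoothing parameters `β i`. -/
def logit (β : A → ℝ) (x : State S) : State S := fun i r =>
  Real.exp (β i * x i r) / ∑ q, Real.exp (β i * x i q)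

/-- The maximal unilateral deviation payoff: the maximum of `|G^i(r, a^{-i}) - G^i(r, b^{-i})|`
over all players `i`, all strategies `r` of `i` and all opponents' profiles that differ in exactly
one coordinate. The pairs `(r, a^{-i})`, `(r, b^{-i})` are written as profiles `a`, `b` with
`a i = b i`. The value is `0` if there is no such pair. -/
def eta (G : A → Profile S → ℝ) : ℝ :=
  sSup {d | ∃ (i : A) (a b : Profile S), a i = b i ∧ (∃! k, a k ≠ b k) ∧ d = |G i a - G i b|}

/-- `max_i ∑_{j ≠ i} β j`. -/
def alpha [Nonempty A] (β : A → ℝ) : ℝ :=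
  Finset.univ.sup' Finset.univ_nonempty fun i => ∑ j ∈ Finset.univ.erase i, β j

/-- The vector field of the continuous dynamics of the process of Cominetti et al. -/
def Phi (G : A → Profile S → ℝ) (β : A → ℝ) (x : State S) : State S := fun i r =>
  logit β x i r * (payoffAgainst G i r (logit β x) - x i r)

/-- First component of the vector field of the continuous dynamics of the adjusted process. -/
def PsiX (G : A → Profile S → ℝ) (β : A → ℝ) (x l : State S) : State S := fun i r =>
  logit β x i r / l i r * (payoffAgainst G i r (logit β x) - x i r)

/-- Second component of the vector field of the continuous dynamics of the adjusted process. -/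
def PsiL (β : A → ℝ) (x l : State S) : State S := fun i r => logit β x i r - l i r

/-- Rest points of the dynamics `x' = Phi x`. -/
def IsRestPhi (G : A → Profile S → ℝ) (β : A → ℝ) (x : State S) : Prop := Phi G β x = 0

/-- Rest points `(x, l)`, with `l` a mixed profile, of the dynamics `x' = PsiX`, `l' = PsiL`.
The equation `PsiL = 0` forces `l` to be positive, so no division by zero is involved. -/
def IsRestPsi (G : A → Profile S → ℝ) (β : A → ℝ) (x l : State S) : Prop :=
  l ∈ mixed S ∧ PsiX G β x l = 0 ∧ PsiL β x l = 0

/-- The Jacobian matrix of `H` at `x`: the entry at `((i, r), (j, q))` is the partial derivative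
of the coordinate `(i, r)` of `H` with respect to the coordinate `(j, q)`. -/
def jacobian (H : State S → State S) (x : State S) : Matrix (Σ i, S i) (Σ i, S i) ℝ :=
  Matrix.of fun p q => fderiv ℝ H x (Pi.single q.1 (Pi.single q.2 1)) p.1 p.2

/-- The maximal real part of the complex eigenvalues of a real square matrix. -/
def rho {ι : Type*} [Fintype ι] [DecidableEq ι] (B : Matrix ι ι ℝ) : ℝ :=
  sSup {t | ∃ z : ℂ,
    Module.End.HasEigenvalue (Matrix.toLin' (B.map (fun b : ℝ => (b : ℂ)))) z ∧ t = z.re}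

/-- Perception vectors of the process of Cominetti et al. with step sizes `1 / n`, along the
sequence `s 1, s 2, …` of profiles played (`s 0` is not used). -/
def cmsProcess (G : A → Profile S → ℝ) (x0 : State S) (s : ℕ → Profile S) : ℕ → State S
  | 0 => x0
  | n + 1 => fun i r =>
      if r = s (n + 1) i then
        (1 - 1 / ((n : ℝ) + 1)) * cmsProcess G x0 s n i r + 1 / ((n : ℝ) + 1) * G i (s (n + 1))
      else cmsProcess G x0 s n i r

/-- Number of times that each strategy has been used up to time `n`, with initial value `θ0`. -/
def count (θ0 : State S) (s : ℕ → Profile S) (n : ℕ) : State S := fun i r =>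
  θ0 i r + (((Finset.Icc 1 n).filter fun m => s m i = r).card : ℝ)

/-- Empirical frequencies of play up to time `n`. -/
def freq (θ0 : State S) (s : ℕ → Profile S) (n : ℕ) : State S := fun i r =>
  count θ0 s n i r / ((n : ℝ) + 1)

/-- Perception vectors of the adjusted process, along the sequence of profiles played. -/
def apProcess (G : A → Profile S → ℝ) (x0 θ0 : State S) (s : ℕ → Profile S) : ℕ → State S
  | 0 => x0
  | n + 1 => fun i r =>
      if r = s (n + 1) i then
        (1 - 1 / count θ0 s n i r) * apProcess G x0 θ0 s n i r
          + 1 / count θ0 s n i r * G i (s (n + 1))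
      else apProcess G x0 θ0 s n i r

/-- The σ-algebra generated by the profiles played and the payoffs scored at stages `1, …, n`. -/
abbrev history {Ω : Type*} (G : A → Profile S → ℝ) (s : ℕ → Ω → Profile S) (n : ℕ) :
    MeasurableSpace Ω :=
  ⨆ m ∈ Finset.Icc 1 n, MeasurableSpace.comap
    (fun ω => (s m ω, fun i => G i (s m ω)))
    (MeasurableSpace.prod (⊤ : MeasurableSpace (Profile S)) (inferInstance : MeasurableSpace (A → ℝ)))

/-- The random profiles `s 1, s 2, …` are played according to the Logit rule applied to the
perceptions `x`: conditionally on the history up to time `n`, the players draw their strategies of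
stage `n + 1` independently of each other, player `i` with law `logit β (x n) i`. -/
structure IsPlay {Ω : Type*} [MeasurableSpace Ω] (μ : Measure Ω) (G : A → Profile S → ℝ)
    (β : A → ℝ) (s : ℕ → Ω → Profile S) (x : ℕ → Ω → State S) : Prop where
  measurableSet_eq : ∀ (n : ℕ) (a : Profile S), MeasurableSet {ω | s (n + 1) ω = a}
  condLaw : ∀ (n : ℕ) (a : Profile S),
    μ[{ω | s (n + 1) ω = a}.indicator (fun _ => (1 : ℝ)) | history G s n]
      =ᵐ[μ] fun ω => ∏ i, logit β (x n ω) i (a i)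

end LearningGame

end

set_option linter.unusedSectionVars false

namespace LearningGame

variable {A : Type*} [Fintype A] [DecidableEq A] {S : A → Type*} [∀ i, Fintype (S i)]
  [∀ i, DecidableEq (S i)]

/-! Write L = `eta G * alpha β`, F = `logitPayoff G β`, and use sup norms. The derivative of a logit
average is a covariance, so moving player j's perceptions by d changes a payoff by at most `β j *
eta G * d`. A player's own perceptions never enter F. Changing players one at a time shows that F is
L-Lipschitz. Since logit probabilities are positive, the zeros of both vector fields are governed by
the fixed point of F, which is unique by the contraction principle.

Both processes are driven by bounded martingale differences U. By L² martingale convergence the sums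
of (k+1)^(δ-1) U_k converge almost surely when δ < 1/2 (`ae_exists_tendsto_noise`). What remains is
deterministic and reduces to `tendsto_zero_of_recursion`: a drift -κ/(n+1) with errors o(1/n) forces
convergence to 0. Noise is removed by adding the tail of its convergent series to the unknown, so
that the increments of the two cancel.

For the process of Cominetti et al., boundedness keeps the logit probabilities above some c > 0, and
the contraction gives convergence with drift c(1-L) (`tendsto_of_noise_convergent`). For the rate,
`Phi` is linearised at the limit. All eigenvalues of its Jacobian have negative real part by
Gershgorin (`re_eigenvalue_neg`), and in an adapted norm the Euler steps contract at any rate c <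
|ρ| (`exists_adapted_seminorm`), which beats the growth of n^δ for δ < c
(`tendsto_rpow_smul_sub_of_seminorm`). The noise demands δ < 1/2, and this is automatic: a trace
computation gives |ρ| ≤ 1/2 once some player has two strategies (`neg_half_le_rho_jacobian`).
Otherwise the process is constant from stage 1 on.

For the adjusted process, x_n - x_* is, up to noise o(n^(1-δ)) divided by n, an average of F(x_m) -
x_* with weights σ_m, where |F(x_m) - x_*| ≤ L‖x_m - x_*‖. Such averages decay at any rate δ <
κ(1-L) if the last weight is at least κ/n of the total (`tendsto_rpow_smul_of_average`). A crude κ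
with δ = 0 gives convergence. Then σ_m converges, every κ < 1 is admissible, and κ = 2δ works
because 2L < 1; this is where the factor 2 in the hypothesis is used. The frequencies inherit the
rate through Cesàro means. -/

lemma abs_apply_le_norm (x : State S) (i : A) (r : S i) : |x i r| ≤ ‖x‖ :=
  (norm_le_pi_norm (x i) r).trans (norm_le_pi_norm x i)

/-! ### The logit rule -/

section Logit

variable [∀ i, Nonempty (S i)]

lemma logit_denom_pos (β : A → ℝ) (x : State S) (i : A) :
    0 < ∑ q, Real.exp (β i * x i q) :=
  Finset.sum_pos (fun _ _ => Real.exp_pos _) Finset.univ_nonempty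

lemma logit_pos (β : A → ℝ) (x : State S) (i : A) (r : S i) : 0 < logit β x i r :=
  div_pos (Real.exp_pos _) (logit_denom_pos β x i)

lemma sum_logit (β : A → ℝ) (x : State S) (i : A) : ∑ r, logit β x i r = 1 := by
  simp only [logit, ← Finset.sum_div]
  exact div_self (logit_denom_pos β x i).ne'

lemma logit_le_one (β : A → ℝ) (x : State S) (i : A) (r : S i) : logit β x i r ≤ 1 := by
  rw [← sum_logit β x i]
  exact Finset.single_le_sum (f := fun r => logit β x i r) (fun q _ => (logit_pos β x i q).le)
    (Finset.mem_univ r)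

lemma logit_mem_mixed (β : A → ℝ) (x : State S) : logit β x ∈ mixed S :=
  fun i => ⟨fun r => (logit_pos β x i r).le, sum_logit β x i⟩

lemma logit_congr (β : A → ℝ) {x y : State S} {i : A} (h : x i = y i) :
    logit β x i = logit β y i := by
  funext r
  simp only [logit, h]

/-- On bounded sets of perceptions the logit probabilities are bounded away from zero. -/
lemma exists_logit_ge (β : A → ℝ) (hβ : ∀ i, 0 < β i) (i : A) (K : ℝ) :
    ∃ c > 0, ∀ x : State S, (∀ r, |x i r| ≤ K) → ∀ r, c ≤ logit β x i r := by
  refine ⟨Real.exp (β i * (-K)) / ∑ _q : S i, Real.exp (β i * K), ?_, fun x hx r => ?_⟩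
  · exact div_pos (Real.exp_pos _)
      (Finset.sum_pos (fun _ _ => Real.exp_pos _) Finset.univ_nonempty)
  · refine div_le_div₀ (Real.exp_pos _).le ?_ (logit_denom_pos β x i) ?_
    · exact Real.exp_le_exp.2 (mul_le_mul_of_nonneg_left (abs_le.1 (hx r)).1 (hβ i).le)
    · exact Finset.sum_le_sum fun q _ =>
        Real.exp_le_exp.2 (mul_le_mul_of_nonneg_left (abs_le.1 (hx q)).2 (hβ i).le)

lemma differentiable_logit (β : A → ℝ) (i : A) (r : S i) :
    Differentiable ℝ fun x : State S => logit β x i r := by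
  have h : ∀ q : S i, Differentiable ℝ fun x : State S => Real.exp (β i * x i q) := fun q => by
    fun_prop
  have hs : Differentiable ℝ fun x : State S => ∑ q, Real.exp (β i * x i q) :=
    Differentiable.fun_sum fun q _ => h q
  have hm : Differentiable ℝ fun x : State S =>
      Real.exp (β i * x i r) * (∑ q, Real.exp (β i * x i q))⁻¹ :=
    fun x => (h r x).mul ((hs x).inv (logit_denom_pos β x i).ne')
  simpa only [logit, div_eq_mul_inv] using hm

lemma continuous_logit (β : A → ℝ) (i : A) (r : S i) :
    Continuous fun x : State S => logit β x i r :=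
  (differentiable_logit β i r).continuous

/-- The average of a function of oscillation at most `η` under the logit rule is Lipschitz. -/
lemma abs_sum_mul_logit_sub_le (β : A → ℝ) (hβ : ∀ i, 0 < β i) (i : A) (g : S i → ℝ) {η : ℝ}
    (hg : ∀ r q, |g r - g q| ≤ η) (x y : State S) {d : ℝ} (hd : ∀ r, |x i r - y i r| ≤ d) :
    |∑ r, logit β x i r * g r - ∑ r, logit β y i r * g r| ≤ β i * η * d := by
  -- Interpolate along the segment from `y` to `x`: `N t / Z t` is the average of `g` under the
  -- logit rule at parameter t, and the mean value inequality is applied between 0 and 1.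
  set v : S i → ℝ := fun r => β i * (x i r - y i r) with hv
  set e : ℝ → S i → ℝ := fun t r => Real.exp (β i * y i r + t * v r) with he
  have hepos : ∀ t r, 0 < e t r := fun t r => Real.exp_pos _
  set Z : ℝ → ℝ := fun t => ∑ r, e t r with hZ
  have hZpos : ∀ t, 0 < Z t := fun t =>
    Finset.sum_pos (fun r _ => hepos t r) Finset.univ_nonempty
  set N : ℝ → ℝ := fun t => ∑ r, e t r * g r with hN
  have hed : ∀ t r, HasDerivAt (fun t => e t r) (e t r * v r) t := fun t r => by
    have : HasDerivAt (fun t => β i * y i r + t * v r) (v r) t := by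
      simpa using ((hasDerivAt_id t).mul_const (v r)).const_add (β i * y i r)
    exact this.exp
  have hZd : ∀ t, HasDerivAt Z (∑ r, e t r * v r) t := fun t =>
    HasDerivAt.fun_sum fun r _ => hed t r
  have hNd : ∀ t, HasDerivAt N (∑ r, e t r * v r * g r) t := fun t =>
    HasDerivAt.fun_sum fun r _ => (hed t r).mul_const (g r)
  have hfd : ∀ t, HasDerivAt (fun t => N t / Z t)
      (((∑ r, e t r * v r * g r) * Z t - N t * (∑ r, e t r * v r)) / Z t ^ 2) t := fun t =>
    (hNd t).div (hZd t) (hZpos t).ne'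
  have hvd : ∀ r, |v r| ≤ β i * d := fun r => by
    rw [hv, abs_mul, abs_of_pos (hβ i)]
    exact mul_le_mul_of_nonneg_left (hd r) (hβ i).le
  have hbound : ∀ t, ‖((∑ r, e t r * v r * g r) * Z t - N t * (∑ r, e t r * v r)) / Z t ^ 2‖
      ≤ β i * η * d := fun t => by
    -- The numerator of the derivative is a covariance; as a double sum it involves only differences
    -- of `g`, hence only its oscillation.
    have h1 : (∑ r, e t r * v r * g r) * Z t - N t * (∑ r, e t r * v r)
        = ∑ r, ∑ q, e t r * e t q * (v r * (g r - g q)) := by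
      have h2 : N t * (∑ r, e t r * v r) = (∑ r, e t r * v r) * N t := mul_comm _ _
      rw [h2, hZ, hN]
      simp only [Finset.sum_mul_sum, ← Finset.sum_sub_distrib]
      exact Finset.sum_congr rfl fun r _ => Finset.sum_congr rfl fun q _ => by ring
    rw [norm_div, Real.norm_eq_abs, Real.norm_eq_abs, abs_of_pos (pow_pos (hZpos t) 2),
      div_le_iff₀ (pow_pos (hZpos t) 2), h1]
    calc |∑ r, ∑ q, e t r * e t q * (v r * (g r - g q))|
        ≤ ∑ r, ∑ q, e t r * e t q * (β i * η * d) := by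
          refine (Finset.abs_sum_le_sum_abs _ _).trans (Finset.sum_le_sum fun r _ => ?_)
          refine (Finset.abs_sum_le_sum_abs _ _).trans (Finset.sum_le_sum fun q _ => ?_)
          rw [abs_mul, abs_of_pos (mul_pos (hepos t r) (hepos t q)), abs_mul]
          refine mul_le_mul_of_nonneg_left ?_ (mul_pos (hepos t r) (hepos t q)).le
          calc |v r| * |g r - g q| ≤ (β i * d) * η :=
                mul_le_mul (hvd r) (hg r q) (abs_nonneg _) ((abs_nonneg _).trans (hvd r))
            _ = β i * η * d := by ring
      _ = β i * η * d * Z t ^ 2 := by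
          simp only [← Finset.sum_mul, ← Finset.mul_sum]
          rw [hZ]; ring
  have key := norm_image_sub_le_of_norm_deriv_le_segment_01' (f := fun t => N t / Z t)
    (fun t _ => (hfd t).hasDerivWithinAt) (fun t _ => hbound t)
  have h1 : N 1 / Z 1 = ∑ r, logit β x i r * g r := by
    have : ∀ r, e 1 r = Real.exp (β i * x i r) := fun r => by
      simp only [he, hv]; congr 1; ring
    simp only [hN, hZ, this, logit, Finset.sum_div]
    exact Finset.sum_congr rfl fun r _ => by ring
  have h0 : N 0 / Z 0 = ∑ r, logit β y i r * g r := by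
    have : ∀ r, e 0 r = Real.exp (β i * y i r) := fun r => by
      simp only [he]; congr 1; ring
    simp only [hN, hZ, this, logit, Finset.sum_div]
    exact Finset.sum_congr rfl fun r _ => by ring
  rw [← h1, ← h0]
  exact key

/-- A logit probability is the average of an indicator, whose oscillation is at most 1. -/
lemma abs_logit_sub_le (β : A → ℝ) (hβ : ∀ i, 0 < β i) (x y : State S) (i : A) (r : S i) :
    |logit β x i r - logit β y i r| ≤ β i * ‖x - y‖ := by
  have h := abs_sum_mul_logit_sub_le β hβ i (Pi.single r (1 : ℝ)) (η := 1) (fun p q => by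
    by_cases hp : p = r <;> by_cases hq : q = r <;> simp [hp, hq]) x y
    (d := ‖x - y‖) (abs_apply_le_norm (x - y) i)
  simpa [Pi.single_apply] using h

end Logit

/-! ### Payoffs -/

lemma sum_prod_eq_one {p : State S} (hp : ∀ i, ∑ r, p i r = 1) :
    ∑ a : Profile S, ∏ k, p k (a k) = 1 := by
  rw [← Fintype.prod_sum]
  exact Finset.prod_eq_one fun i _ => hp i

/-- Fubini's theorem for one factor of a product distribution. -/
lemma sum_mul_prod_update (f : Profile S → ℝ) (p : State S) (j : A) (q : S j → ℝ)
    (hp : ∑ r, p j r = 1) :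
    ∑ a : Profile S, f a * ∏ k, Function.update p j q k (a k)
      = ∑ a : Profile S, (∑ r, q r * f (Function.update a j r)) * ∏ k, p k (a k) := by
  have hprod : ∀ (p : State S) (b : S j) (c : (k : {k // k ≠ j}) → S k),
      ∏ k, p k ((Equiv.piSplitAt j S).symm (b, c) k) = p j b * ∏ k : {k // k ≠ j}, p k (c k) := by
    intro p b c
    rw [Fintype.prod_eq_mul_prod_subtype_ne _ j]
    congr 1
    · simp [Equiv.piSplitAt]
    · refine Finset.prod_congr rfl fun k _ => ?_
      have := k.2
      simp [Equiv.piSplitAt, this]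
  have hupd : ∀ (r b : S j) (c : (k : {k // k ≠ j}) → S k),
      Function.update ((Equiv.piSplitAt j S).symm (b, c)) j r
        = (Equiv.piSplitAt j S).symm (r, c) := by
    intro r b c
    ext k
    by_cases hk : k = j
    · subst hk; simp [Equiv.piSplitAt]
    · simp [Equiv.piSplitAt, hk]
  rw [← (Equiv.piSplitAt j S).symm.sum_comp, ← (Equiv.piSplitAt j S).symm.sum_comp,
    Fintype.sum_prod_type_right, Fintype.sum_prod_type_right]
  refine Finset.sum_congr rfl fun c _ => ?_
  simp only [hprod, hupd, Function.update_self]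
  have : ∏ k : {k // k ≠ j}, Function.update p j q k (c k) = ∏ k : {k // k ≠ j}, p k (c k) :=
    Finset.prod_congr rfl fun k _ => by rw [Function.update_of_ne k.2]
  rw [this]
  simp only [← mul_assoc, ← Finset.sum_mul, ← Finset.mul_sum]
  rw [hp, mul_one]
  congr 1
  exact Finset.sum_congr rfl fun r _ => mul_comm _ _

/-- Isolates player `j`: the inner sum no longer depends on `q`, because `p j` survives in it only
as a dummy factor of total mass 1. -/
lemma payoff_update (G : A → Profile S → ℝ) (i : A) {p : State S} (hp : ∀ i, ∑ r, p i r = 1)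
    (j : A) (q : S j → ℝ) :
    payoff G i (Function.update p j q)
      = ∑ r, q r * ∑ a : Profile S, G i (Function.update a j r) * ∏ k, p k (a k) := by
  rw [payoff, sum_mul_prod_update _ _ _ _ (hp j)]
  simp only [Finset.mul_sum, Finset.sum_mul]
  rw [Finset.sum_comm]
  exact Finset.sum_congr rfl fun r _ => Finset.sum_congr rfl fun a _ => by ring

/-- The weight of the profiles in which `i` plays `r`. -/
lemma mul_prod_update_single (p : State S) (i : A) (r : S i) (a : Profile S) :
    p i r * ∏ k, Function.update p i (Pi.single r 1) k (a k)
      = if a i = r then ∏ k, p k (a k) else 0 := by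
  rw [Fintype.prod_eq_mul_prod_subtype_ne _ i, Function.update_self]
  have : ∏ k : {k // k ≠ i}, Function.update p i (Pi.single r 1) k (a k)
      = ∏ k : {k // k ≠ i}, p k (a k) :=
    Finset.prod_congr rfl fun k _ => by rw [Function.update_of_ne k.2]
  rw [this]
  split_ifs with h
  · rw [Fintype.prod_eq_mul_prod_subtype_ne (fun k => p k (a k)) i, h]
    simp
  · simp [h]

/-- The factor `p i r` restores the missing weight of player `i`. In this form the payoff appears as
the mean of what is received at a stage on the event that `r` is played. -/
lemma mul_payoffAgainst (G : A → Profile S → ℝ) (p : State S) (i : A) (r : S i) :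
    p i r * payoffAgainst G i r p
      = ∑ a : Profile S, (if a i = r then G i a else 0) * ∏ k, p k (a k) := by
  rw [payoffAgainst, payoff, Finset.mul_sum]
  refine Finset.sum_congr rfl fun a _ => ?_
  rw [mul_left_comm, mul_prod_update_single]
  split_ifs <;> simp

lemma sum_ite_mul_prod {p : State S} (hp : ∀ i, ∑ r, p i r = 1) (i : A) (r : S i) :
    ∑ a : Profile S, (if a i = r then 1 else 0) * ∏ k, p k (a k) = p i r := by
  have h := mul_payoffAgainst (fun _ _ => 1) p i r
  rw [← h, payoffAgainst, payoff]
  simp only [one_mul]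
  rw [sum_prod_eq_one, mul_one]
  intro j
  by_cases hj : j = i
  · subst hj; simp
  · rw [Function.update_of_ne hj, hp]

/-- The payoff of player `i` is changed by at most `eta G` when one opponent changes strategy. -/
lemma abs_sub_le_eta (G : A → Profile S → ℝ) {i j : A} (hij : j ≠ i) (a : Profile S) (r q : S j) :
    |G i (Function.update a j r) - G i (Function.update a j q)| ≤ eta G := by
  have hbdd : BddAbove {d | ∃ (i : A) (a b : Profile S), a i = b i ∧ (∃! k, a k ≠ b k) ∧
      d = |G i a - G i b|} := by
    refine Set.Finite.bddAbove ((Set.finite_range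
      fun t : A × Profile S × Profile S => |G t.1 t.2.1 - G t.1 t.2.2|).subset ?_)
    rintro d ⟨i, a, b, -, -, rfl⟩
    exact ⟨(i, a, b), rfl⟩
  by_cases hrq : r = q
  · subst hrq
    rw [sub_self, abs_zero]
    refine Real.sSup_nonneg ?_
    rintro d ⟨i, a, b, -, -, rfl⟩
    exact abs_nonneg _
  · refine le_csSup hbdd ⟨i, _, _, ?_, ⟨j, by simpa using hrq, fun k hk => ?_⟩, rfl⟩
    · simp [Function.update_of_ne hij.symm]
    · by_contra hkj
      simp [Function.update_of_ne hkj] at hk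

lemma eta_nonneg (G : A → Profile S → ℝ) : 0 ≤ eta G := by
  refine Real.sSup_nonneg ?_
  rintro d ⟨i, a, b, -, -, rfl⟩
  exact abs_nonneg _

/-! ### The map whose fixed point is the rest point -/

/-- Expected payoffs against opponents who follow the logit rule. -/
noncomputable def logitPayoff (G : A → Profile S → ℝ) (β : A → ℝ) (x : State S) : State S :=
  fun i r => payoffAgainst G i r (logit β x)

lemma Phi_apply (G : A → Profile S → ℝ) (β : A → ℝ) (x : State S) (i : A) (r : S i) :
    Phi G β x i r = logit β x i r * (logitPayoff G β x i r - x i r) := rfl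

section

variable [∀ i, Nonempty (S i)]

/-- Player `i`'s logit component is overwritten by a pure strategy. Hence `alpha` omits `β i`, and
the derivative of `logitPayoff` vanishes on the diagonal blocks. -/
lemma logitPayoff_update_self (G : A → Profile S → ℝ) (β : A → ℝ) (x : State S) (i : A)
    (u : S i → ℝ) : logitPayoff G β (Function.update x i u) i = logitPayoff G β x i := by
  ext r
  simp only [logitPayoff, payoffAgainst]
  congr 1
  ext k : 1
  by_cases hk : k = i
  · subst hk; simp
  · rw [Function.update_of_ne hk, Function.update_of_ne hk]
    exact logit_congr β (Function.update_of_ne hk _ _)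

/-- With all players but `j` frozen, the payoff is an average under `j`'s logit rule of a function
`g` of oscillation at most `eta G`, so `abs_sum_mul_logit_sub_le` applies. -/
lemma abs_logitPayoff_update_sub_le (G : A → Profile S → ℝ) (β : A → ℝ) (hβ : ∀ i, 0 < β i)
    {i j : A} (hij : j ≠ i) (r : S i) (x : State S) (u w : S j → ℝ) {d : ℝ}
    (hd : ∀ q, |u q - w q| ≤ d) :
    |logitPayoff G β (Function.update x j u) i r - logitPayoff G β (Function.update x j w) i r|
      ≤ β j * eta G * d := by
  set p : State S := Function.update (logit β x) i (Pi.single r 1) with hpdef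
  have hp : ∀ k, ∑ q, p k q = 1 := fun k => by
    by_cases hk : k = i
    · subst hk; simp [hpdef]
    · rw [hpdef, Function.update_of_ne hk, sum_logit]
  have hp0 : ∀ k q, 0 ≤ p k q := fun k q => by
    by_cases hk : k = i
    · subst hk
      by_cases hq : q = r <;> simp [hpdef, hq]
    · rw [hpdef, Function.update_of_ne hk]
      exact (logit_pos β x k q).le
  set g : S j → ℝ := fun q => ∑ a : Profile S, G i (Function.update a j q) * ∏ k, p k (a k)
  have key : ∀ v : S j → ℝ, logitPayoff G β (Function.update x j v) i r
      = ∑ q, logit β (Function.update x j v) j q * g q := fun v => by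
    rw [← payoff_update G i hp, logitPayoff, payoffAgainst]
    congr 1
    ext k : 1
    by_cases hk : k = i
    · subst hk; simp [hpdef, Function.update_of_ne hij.symm]
    · rw [Function.update_of_ne hk]
      by_cases hkj : k = j
      · subst hkj; simp
      · rw [Function.update_of_ne hkj, hpdef, Function.update_of_ne hk]
        exact logit_congr β (Function.update_of_ne hkj _ _)
  rw [key, key]
  refine abs_sum_mul_logit_sub_le β hβ j g (fun r q => ?_) _ _ (fun q => by simpa using hd q)
  simp only [g, ← Finset.sum_sub_distrib, ← sub_mul]
  calc |∑ a : Profile S, (G i (Function.update a j r) - G i (Function.update a j q)) *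
        ∏ k, p k (a k)|
      ≤ ∑ a : Profile S, eta G * ∏ k, p k (a k) := by
        refine (Finset.abs_sum_le_sum_abs _ _).trans (Finset.sum_le_sum fun a _ => ?_)
        have h0 : 0 ≤ ∏ k, p k (a k) := Finset.prod_nonneg fun k _ => hp0 k _
        rw [abs_mul, abs_of_nonneg h0]
        exact mul_le_mul_of_nonneg_right (abs_sub_le_eta G hij a r q) h0
    _ = eta G := by rw [← Finset.mul_sum, sum_prod_eq_one hp, mul_one]

lemma abs_logitPayoff_sub_le (G : A → Profile S → ℝ) (β : A → ℝ) (hβ : ∀ i, 0 < β i)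
    [Nonempty A] (x y : State S) (i : A) (r : S i) :
    |logitPayoff G β x i r - logitPayoff G β y i r| ≤ eta G * alpha β * ‖x - y‖ := by
  -- Pass from `y` to `x` one player at a time: each `j ≠ i` costs `β j * eta G * ‖x - y‖`, and `i`
  -- costs nothing.
  have hT : ∀ T : Finset A, |logitPayoff G β (T.piecewise x y) i r - logitPayoff G β y i r|
      ≤ (∑ j ∈ T.erase i, β j) * (eta G * ‖x - y‖) := by
    intro T
    induction T using Finset.induction_on with
    | empty => simp
    | insert j T hj ih =>
      rw [Finset.piecewise_insert]
      have hy : T.piecewise x y = Function.update (T.piecewise x y) j (y j) := by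
        conv_lhs => rw [← Function.update_eq_self j (T.piecewise x y)]
        rw [Finset.piecewise_eq_of_notMem _ _ _ hj]
      by_cases hji : j = i
      · subst hji
        rw [Finset.erase_insert hj, logitPayoff_update_self]
        rwa [Finset.erase_eq_of_notMem hj] at ih
      · rw [Finset.erase_insert_of_ne hji, Finset.sum_insert (by simp [hj]), add_mul]
        refine (abs_sub_le _ (logitPayoff G β (T.piecewise x y) i r) _).trans (add_le_add ?_ ih)
        conv_lhs => rw [hy]
        rw [Function.update_idem, ← mul_assoc]
        exact abs_logitPayoff_update_sub_le G β hβ hji r _ _ _ (abs_apply_le_norm (x - y) j)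
  have h := hT Finset.univ
  rw [Finset.piecewise_univ] at h
  refine h.trans ?_
  rw [show eta G * alpha β * ‖x - y‖ = alpha β * (eta G * ‖x - y‖) by ring]
  refine mul_le_mul_of_nonneg_right ?_ (mul_nonneg (eta_nonneg G) (norm_nonneg _))
  exact Finset.le_sup' (fun i => ∑ j ∈ Finset.univ.erase i, β j) (Finset.mem_univ i)

lemma alpha_nonneg [Nonempty A] (β : A → ℝ) (hβ : ∀ i, 0 < β i) : 0 ≤ alpha β := by
  obtain ⟨i⟩ := ‹Nonempty A›
  exact (Finset.sum_nonneg fun j _ => (hβ j).le).trans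
    (Finset.le_sup' (fun i => ∑ j ∈ Finset.univ.erase i, β j) (Finset.mem_univ i))

lemma norm_logitPayoff_sub_le [Nonempty A] (G : A → Profile S → ℝ) (β : A → ℝ)
    (hβ : ∀ i, 0 < β i) (x y : State S) :
    ‖logitPayoff G β x - logitPayoff G β y‖ ≤ eta G * alpha β * ‖x - y‖ := by
  have h0 : 0 ≤ eta G * alpha β * ‖x - y‖ :=
    mul_nonneg (mul_nonneg (eta_nonneg G) (alpha_nonneg β hβ)) (norm_nonneg _)
  exact (pi_norm_le_iff_of_nonneg h0).2 fun i => (pi_norm_le_iff_of_nonneg h0).2 fun r =>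
    abs_logitPayoff_sub_le G β hβ x y i r

/-- The expected payoff map has exactly one fixed point when it is a contraction. -/
lemma existsUnique_logitPayoff_eq [Nonempty A] (G : A → Profile S → ℝ) (β : A → ℝ)
    (hβ : ∀ i, 0 < β i) (h : eta G * alpha β < 1) : ∃! x, logitPayoff G β x = x := by
  have h0 : 0 ≤ eta G * alpha β := mul_nonneg (eta_nonneg G) (alpha_nonneg β hβ)
  have hc : ContractingWith ⟨eta G * alpha β, h0⟩ (logitPayoff G β) :=
    ⟨h, LipschitzWith.of_dist_le_mul fun x y => by
      rw [dist_eq_norm, dist_eq_norm]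
      exact norm_logitPayoff_sub_le G β hβ x y⟩
  exact ⟨_, hc.fixedPoint_isFixedPt, fun y hy => hc.fixedPoint_unique hy⟩

lemma isRestPhi_iff (G : A → Profile S → ℝ) (β : A → ℝ) (x : State S) :
    IsRestPhi G β x ↔ logitPayoff G β x = x := by
  constructor
  · intro h
    ext i r
    have := congrFun (congrFun h i) r
    rw [Phi_apply] at this
    exact sub_eq_zero.1 ((mul_eq_zero.1 this).resolve_left (logit_pos β x i r).ne')
  · intro h
    ext i r
    rw [Phi_apply, h]
    simp

lemma isRestPsi_iff (G : A → Profile S → ℝ) (β : A → ℝ) (x l : State S) :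
    IsRestPsi G β x l ↔ logitPayoff G β x = x ∧ l = logit β x := by
  constructor
  · rintro ⟨-, hx, hl⟩
    have hl' : l = logit β x := by
      ext i r
      exact (sub_eq_zero.1 (congrFun (congrFun hl i) r)).symm
    refine ⟨?_, hl'⟩
    ext i r
    have := congrFun (congrFun hx i) r
    rw [PsiX, hl', div_self (logit_pos β x i r).ne', one_mul] at this
    exact sub_eq_zero.1 this
  · rintro ⟨hx, rfl⟩
    refine ⟨logit_mem_mixed β x, ?_, ?_⟩
    · ext i r
      have : payoffAgainst G i r (logit β x) = x i r := congrFun (congrFun hx i) r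
      simp [PsiX, this]
    · ext i r
      simp [PsiL]

lemma differentiable_logitPayoff (G : A → Profile S → ℝ) (β : A → ℝ) :
    Differentiable ℝ (logitPayoff G β : State S → State S) := by
  refine differentiable_pi.2 fun i => differentiable_pi.2 fun r => ?_
  have h : ∀ (k : A) (q : S k), Differentiable ℝ fun x : State S =>
      Function.update (logit β x) i (Pi.single r 1) k q := fun k q => by
    by_cases hk : k = i
    · subst hk; simp
    · simp only [Function.update_of_ne hk]
      exact differentiable_logit β k q
  have hp : ∀ a : Profile S, Differentiable ℝ fun x : State S =>
      ∏ k, Function.update (logit β x) i (Pi.single r 1) k (a k) := fun a x =>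
    (HasFDerivAt.finsetProd fun k _ => (h k (a k) x).hasFDerivAt).differentiableAt
  have hm : ∀ a : Profile S, Differentiable ℝ fun x : State S =>
      G i a * ∏ k, Function.update (logit β x) i (Pi.single r 1) k (a k) := fun a =>
    (hp a).const_mul (G i a)
  exact Differentiable.fun_sum fun a _ => hm a

lemma differentiable_Phi (G : A → Profile S → ℝ) (β : A → ℝ) :
    Differentiable ℝ (Phi G β : State S → State S) := by
  refine differentiable_pi.2 fun i => differentiable_pi.2 fun r => ?_
  simp only [Phi_apply]
  have h := differentiable_pi.1 (differentiable_pi.1 (differentiable_logitPayoff G β) i) r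
  have h' : Differentiable ℝ fun x : State S => x i r := by fun_prop
  have hl : Differentiable ℝ fun x : State S => logit β x i r := differentiable_logit β i r
  exact Differentiable.fun_mul hl (h.sub h')

end

end LearningGame

namespace LearningGame

/-! ### Real sequences -/

/-- A Robbins–Monro type recursion with step sizes `1 / (n + 1)` forces convergence to zero. -/
lemma tendsto_zero_of_recursion {a : ℕ → ℝ} (ha : ∀ n, 0 ≤ a n) {κ : ℝ} (hκ : 0 < κ)
    (h : ∀ ε > 0, ∀ᶠ n : ℕ in atTop,
      a (n + 1) ≤ (1 - κ / ((n : ℝ) + 1)) * a n + ε * (a n + 1) / ((n : ℝ) + 1)) :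
    Tendsto a atTop (𝓝 0) := by
  have hH := Real.tendsto_sum_range_one_div_nat_succ_atTop
  set H : ℕ → ℝ := fun n => ∑ i ∈ Finset.range n, 1 / ((i : ℝ) + 1) with hHdef
  rw [Metric.tendsto_atTop]
  intro e he
  set e' := e / 2 with he'
  have he'0 : 0 < e' := by positivity
  -- The first bound lets half of the drift absorb `ε * a n`; the second keeps the constant error
  -- below the pull towards `e'`. The excess of `a n` over `e'` then shrinks by the factor 1 - κ /
  -- (2(n+1)).
  set ε := min (κ / 2) (κ / 2 * e') with hε
  have hε0 : 0 < ε := lt_min (by positivity) (by positivity)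
  obtain ⟨N, hN⟩ := eventually_atTop.1 ((h ε hε0).and (eventually_ge_atTop ⌈κ⌉₊))
  set b : ℕ → ℝ := fun n => max (a n - e') 0 with hb
  have hb0 : ∀ n, 0 ≤ b n := fun n => le_max_right _ _
  have hstep : ∀ n ≥ N, b (n + 1) ≤ Real.exp (-(κ / 2) * (1 / ((n : ℝ) + 1))) * b n := by
    intro n hn
    obtain ⟨h1, h2⟩ := hN n hn
    have hn1 : (0 : ℝ) < (n : ℝ) + 1 := by positivity
    have hκn : κ ≤ n := (Nat.le_ceil κ).trans (by exact_mod_cast h2)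
    refine max_le ?_ (mul_nonneg (Real.exp_pos _).le (hb0 n))
    have h3 : a (n + 1) - e' ≤ (1 - κ / 2 * (1 / ((n : ℝ) + 1))) * (a n - e') := by
      have e1 : ε * (a n + 1) / ((n : ℝ) + 1)
          ≤ (κ / 2 * a n + κ / 2 * e') / ((n : ℝ) + 1) := by
        refine div_le_div_of_nonneg_right ?_ hn1.le
        have := mul_le_mul_of_nonneg_right (min_le_left (κ / 2) (κ / 2 * e')) (ha n)
        have := min_le_right (κ / 2) (κ / 2 * e')
        rw [mul_add, mul_one]
        linarith
      have e2 : (1 - κ / ((n : ℝ) + 1)) * a n + (κ / 2 * a n + κ / 2 * e') / ((n : ℝ) + 1) - e'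
          = (1 - κ / 2 * (1 / ((n : ℝ) + 1))) * (a n - e') := by
        field_simp
        ring
      linarith
    have h4 : 0 ≤ 1 - κ / 2 * (1 / ((n : ℝ) + 1)) := by
      rw [mul_one_div, sub_nonneg, div_le_one hn1]
      linarith
    calc a (n + 1) - e' ≤ (1 - κ / 2 * (1 / ((n : ℝ) + 1))) * (a n - e') := h3
      _ ≤ (1 - κ / 2 * (1 / ((n : ℝ) + 1))) * b n :=
          mul_le_mul_of_nonneg_left (le_max_left _ _) h4
      _ ≤ Real.exp (-(κ / 2) * (1 / ((n : ℝ) + 1))) * b n := by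
          refine mul_le_mul_of_nonneg_right ?_ (hb0 n)
          have := Real.add_one_le_exp (-(κ / 2) * (1 / ((n : ℝ) + 1)))
          linarith
  -- The product of the factors is at most an exponential of minus a harmonic sum, which diverges.
  have hbound : ∀ n ≥ N, b n ≤ Real.exp (-(κ / 2) * (H n - H N)) * b N := by
    intro n hn
    induction n, hn using Nat.le_induction with
    | base => simp
    | succ n hn ih =>
      refine (hstep n hn).trans ((mul_le_mul_of_nonneg_left ih (Real.exp_pos _).le).trans_eq ?_)
      rw [← mul_assoc, ← Real.exp_add]
      congr 2
      simp only [hHdef, Finset.sum_range_succ]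
      ring
  have hlim : Tendsto (fun n => Real.exp (-(κ / 2) * (H n - H N)) * b N) atTop (𝓝 0) := by
    rw [← zero_mul (b N)]
    refine Tendsto.mul_const _ (Real.tendsto_exp_atBot.comp ?_)
    exact (tendsto_atTop_add_const_right _ (-H N) hH).const_mul_atTop_of_neg (by linarith)
  obtain ⟨N', hN'⟩ := eventually_atTop.1 ((tendsto_order.1 hlim).2 e' he'0)
  refine ⟨max N N', fun n hn => ?_⟩
  rw [Real.dist_eq, sub_zero, abs_of_nonneg (ha n)]
  have h1 := hbound n ((le_max_left _ _).trans hn)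
  have h2 := hN' n ((le_max_right _ _).trans hn)
  have h3 := le_max_left (a n - e') 0
  have h4 : a n - e' ≤ b n := h3
  linarith

lemma rpow_succ_le {δ : ℝ} (h0 : 0 ≤ δ) (h1 : δ ≤ 1) {n : ℕ} (hn : 1 ≤ n) :
    ((n : ℝ) + 1) ^ δ ≤ (1 + δ / n) * (n : ℝ) ^ δ := by
  have hn' : (0 : ℝ) < n := by exact_mod_cast hn
  have h : (n : ℝ) + 1 = (1 + 1 / n) * n := by field_simp
  rw [h, Real.mul_rpow (by positivity) hn'.le]
  refine mul_le_mul_of_nonneg_right ?_ (by positivity)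
  have := rpow_one_add_le_one_add_mul_self (s := 1 / (n : ℝ)) (p := δ)
    (by have : (0 : ℝ) ≤ 1 / n := by positivity
        linarith) h0 h1
  rwa [mul_one_div] at this

/-- Comparison of consecutive values of `n ^ (δ - 1)`. -/
lemma exists_rpow_succ_eq {δ : ℝ} (h0 : 0 ≤ δ) (h1 : δ < 1) {n : ℕ} (hn : 1 ≤ n) :
    ∃ τ, (1 - δ) / ((n : ℝ) + 1) ≤ τ ∧ τ ≤ 1 / ((n : ℝ) + 1) ∧
      ((n : ℝ) + 1) ^ (δ - 1) = (1 - τ) * (n : ℝ) ^ (δ - 1) := by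
  have hn' : (0 : ℝ) < n := by exact_mod_cast hn
  have hn1 : (0 : ℝ) < (n : ℝ) + 1 := by positivity
  have hq : 1 - 1 / ((n : ℝ) + 1) = n / (n + 1) := by field_simp; ring
  refine ⟨1 - (1 - 1 / ((n : ℝ) + 1)) ^ (1 - δ), ?_, ?_, ?_⟩
  · have := rpow_one_add_le_one_add_mul_self (s := -(1 / ((n : ℝ) + 1))) (p := 1 - δ)
      (by rw [neg_le_neg_iff, div_le_one hn1]; linarith) (by linarith) (by linarith)
    rw [← sub_eq_add_neg] at this
    have e : (1 - δ) / ((n : ℝ) + 1) = (1 - δ) * (1 / ((n : ℝ) + 1)) := by ring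
    rw [e]
    linarith
  · have : 1 - 1 / ((n : ℝ) + 1) ≤ (1 - 1 / ((n : ℝ) + 1)) ^ (1 - δ) := by
      have h2 : (0 : ℝ) < 1 - 1 / ((n : ℝ) + 1) := by rw [hq]; positivity
      have h3 : 1 - 1 / ((n : ℝ) + 1) ≤ 1 := by
        have : (0 : ℝ) ≤ 1 / ((n : ℝ) + 1) := by positivity
        linarith
      calc 1 - 1 / ((n : ℝ) + 1) = (1 - 1 / ((n : ℝ) + 1)) ^ (1 : ℝ) := (Real.rpow_one _).symm
        _ ≤ _ := Real.rpow_le_rpow_of_exponent_ge h2 h3 (by linarith)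
    linarith
  · rw [hq, sub_sub_cancel, Real.div_rpow hn'.le hn1.le, ← neg_sub (1 : ℝ) δ,
      Real.rpow_neg hn1.le, Real.rpow_neg hn'.le]
    have := Real.rpow_pos_of_pos hn' (1 - δ)
    field_simp

lemma rpow_sub_one_eq {δ : ℝ} (n : ℕ) :
    ((n : ℝ) + 1) ^ (δ - 1) = ((n : ℝ) + 1) ^ δ / ((n : ℝ) + 1) := by
  rw [Real.rpow_sub_one (by positivity)]

/-- Cesàro means of a sequence that is `o(n ^ (-δ))` are `o(n ^ (-δ))`. -/
lemma tendsto_rpow_mul_sum {δ : ℝ} (h0 : 0 ≤ δ) (h1 : δ < 1) {u : ℕ → ℝ}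
    (hu : Tendsto (fun n : ℕ => ((n : ℝ) + 1) ^ δ * u n) atTop (𝓝 0)) :
    Tendsto (fun n : ℕ => (n : ℝ) ^ (δ - 1) * ∑ k ∈ Finset.range n, u k) atTop (𝓝 0) := by
  rw [tendsto_zero_iff_abs_tendsto_zero]
  refine tendsto_zero_of_recursion (fun n => abs_nonneg _) (sub_pos.2 h1) fun ε hε => ?_
  have hu' := (tendsto_order.1 hu.abs).2 ε (by simpa using hε)
  filter_upwards [hu', eventually_ge_atTop 1] with n hn hn1
  simp only [Function.comp_apply]
  obtain ⟨τ, hτ1, hτ2, hτ⟩ := exists_rpow_succ_eq h0 h1 hn1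
  have hp : (0 : ℝ) < (n : ℝ) + 1 := by positivity
  set Q := ∑ k ∈ Finset.range n, u k
  have hle1 : τ ≤ 1 := hτ2.trans (by
    rw [div_le_one hp]; linarith [(Nat.cast_nonneg n : (0 : ℝ) ≤ n)])
  have e1 : ((n + 1 : ℕ) : ℝ) ^ (δ - 1) * ∑ k ∈ Finset.range (n + 1), u k
      = (1 - τ) * ((n : ℝ) ^ (δ - 1) * Q) + ((n : ℝ) + 1) ^ δ * u n / ((n : ℝ) + 1) := by
    rw [Finset.sum_range_succ, mul_add]
    push_cast
    congr 1
    · rw [hτ]; ring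
    · rw [rpow_sub_one_eq]; ring
  rw [e1]
  refine (abs_add_le _ _).trans (add_le_add ?_ ?_)
  · rw [abs_mul, abs_of_nonneg (sub_nonneg.2 hle1)]
    exact mul_le_mul_of_nonneg_right (by linarith) (abs_nonneg _)
  · rw [abs_div, abs_of_pos hp]
    refine div_le_div_of_nonneg_right (hn.le.trans ?_) hp.le
    nlinarith [abs_nonneg ((n : ℝ) ^ (δ - 1) * Q)]

/-- Kronecker's lemma for the weights `n ^ (1 - δ)`. -/
lemma tendsto_rpow_mul_sum_of_convergent {δ : ℝ} (h0 : 0 ≤ δ) (h1 : δ < 1) {u : ℕ → ℝ} {s : ℝ}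
    (hu : Tendsto (fun n : ℕ => ∑ k ∈ Finset.range n, ((k : ℝ) + 1) ^ (δ - 1) * u k) atTop
      (𝓝 s)) :
    Tendsto (fun n : ℕ => (n : ℝ) ^ (δ - 1) * ∑ k ∈ Finset.range n, u k) atTop (𝓝 0) := by
  set P : ℕ → ℝ := fun n => ∑ k ∈ Finset.range n, ((k : ℝ) + 1) ^ (δ - 1) * u k with hP
  have hT : Tendsto (fun n => s - P n) atTop (𝓝 0) := by simpa using hu.const_sub s
  set B : ℕ → ℝ := fun n => (n : ℝ) ^ (δ - 1) * ∑ k ∈ Finset.range n, u k with hB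
  -- Both `B` and `P` gain the same term (n+1)^(δ-1) u_n at step n, so it cancels in `B n + (s - P
  -- n)`; only the vanishing tail `s - P n` acts as an error.
  suffices hW : Tendsto (fun n => B n + (s - P n)) atTop (𝓝 0) by
    simpa using hW.sub hT
  rw [tendsto_zero_iff_abs_tendsto_zero]
  refine tendsto_zero_of_recursion (fun n => abs_nonneg _) (sub_pos.2 h1) fun ε hε => ?_
  have hT' := (tendsto_order.1 hT.abs).2 ε (by simpa using hε)
  filter_upwards [hT', eventually_ge_atTop 1] with n hn hn1
  simp only [Function.comp_apply]
  obtain ⟨τ, hτ1, hτ2, hτ⟩ := exists_rpow_succ_eq h0 h1 hn1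
  have hp : (0 : ℝ) < (n : ℝ) + 1 := by positivity
  have hτ0 : 0 ≤ τ := le_trans (div_nonneg (by linarith) hp.le) hτ1
  have hle1 : τ ≤ 1 := hτ2.trans (by
    rw [div_le_one hp]; linarith [(Nat.cast_nonneg n : (0 : ℝ) ≤ n)])
  have e1 : B (n + 1) + (s - P (n + 1)) = (1 - τ) * (B n + (s - P n)) + τ * (s - P n) := by
    simp only [hB, hP, Finset.sum_range_succ]
    push_cast
    rw [hτ]
    ring
  rw [e1]
  refine (abs_add_le _ _).trans (add_le_add ?_ ?_)
  · rw [abs_mul, abs_of_nonneg (sub_nonneg.2 hle1)]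
    exact mul_le_mul_of_nonneg_right (by linarith) (abs_nonneg _)
  · rw [abs_mul, abs_of_nonneg hτ0]
    calc τ * |s - P n| ≤ 1 / ((n : ℝ) + 1) * (ε * (|B n + (s - P n)| + 1)) := by
          refine mul_le_mul hτ2 (hn.le.trans ?_) (abs_nonneg _) (by positivity)
          nlinarith [abs_nonneg (B n + (s - P n))]
      _ = _ := by ring

end LearningGame

namespace LearningGame

/-! ### Martingale noise -/

/-- Sums of bounded martingale differences with square summable weights converge. -/
lemma ae_exists_tendsto_sum_of_condExp_eq_zero {Ω : Type*} {m0 : MeasurableSpace Ω}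
    {μ : Measure Ω} [IsProbabilityMeasure μ] (ℱ : Filtration ℕ m0) {ξ : ℕ → Ω → ℝ} {C : ℝ}
    (hm : ∀ n, StronglyMeasurable[ℱ (n + 1)] (ξ n)) (hb : ∀ n ω, |ξ n ω| ≤ C)
    (hc : ∀ n, μ[ξ n | ℱ n] =ᵐ[μ] 0) {w : ℕ → ℝ} (hw : Summable fun n => w n ^ 2) :
    ∀ᵐ ω ∂μ, ∃ l, Tendsto (fun n => ∑ k ∈ Finset.range n, w k * ξ k ω) atTop (𝓝 l) := by
  set M : ℕ → Ω → ℝ := fun n ω => ∑ k ∈ Finset.range n, w k * ξ k ω with hM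
  have hMm : ∀ n, StronglyMeasurable[ℱ n] (M n) := fun n =>
    Finset.stronglyMeasurable_fun_sum _ fun k hk =>
      ((hm k).mono (ℱ.mono (Finset.mem_range.1 hk))).const_mul (w k)
  have hMb : ∀ n, ∃ K, ∀ ω, |M n ω| ≤ K := fun n =>
    ⟨∑ k ∈ Finset.range n, |w k| * C, fun ω => (Finset.abs_sum_le_sum_abs _ _).trans
      (Finset.sum_le_sum fun k _ => by
        rw [abs_mul]; exact mul_le_mul_of_nonneg_left (hb k ω) (abs_nonneg _))⟩
  have int_of_bdd : ∀ {f : Ω → ℝ} {K : ℝ}, StronglyMeasurable f → (∀ ω, |f ω| ≤ K) →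
      Integrable f μ := fun hf hK =>
    Integrable.of_bound hf.aestronglyMeasurable _ (Eventually.of_forall hK)
  have hξi : ∀ n, Integrable (ξ n) μ := fun n => int_of_bdd ((hm n).mono (ℱ.le _)) (hb n)
  have hMi : ∀ n, Integrable (M n) μ := fun n =>
    int_of_bdd ((hMm n).mono (ℱ.le _)) (hMb n).choose_spec
  have hmart : Martingale M ℱ μ := by
    refine martingale_of_condExp_sub_eq_zero_nat hMm hMi fun n => ?_
    have h1 : M (n + 1) - M n = w n • ξ n := by
      ext ω
      simp [hM, Finset.sum_range_succ]
    rw [h1]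
    filter_upwards [condExp_smul (w n) (ξ n) (ℱ n) (μ := μ), hc n] with ω h2 h3
    rw [h2, Pi.smul_apply, h3]
    simp
  -- Orthogonality of increments: second moments add up, so the martingale is bounded in L².
  have hcross : ∀ n, ∫ ω, M n ω * ξ n ω ∂μ = 0 := fun n => by
    obtain ⟨K, hK⟩ := hMb n
    have h1 := condExp_stronglyMeasurable_mul_of_bound (ℱ.le n) (hMm n) (hξi n) K
      (Eventually.of_forall hK)
    have h2 : ∫ ω, (M n * ξ n) ω ∂μ = ∫ ω, (μ[M n * ξ n | ℱ n]) ω ∂μ :=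
      (integral_condExp (ℱ.le n)).symm
    calc ∫ ω, M n ω * ξ n ω ∂μ = ∫ ω, (μ[M n * ξ n | ℱ n]) ω ∂μ := h2
      _ = ∫ _, (0 : ℝ) ∂μ := by
          refine integral_congr_ae ?_
          filter_upwards [h1, hc n] with ω h3 h4
          rw [h3, Pi.mul_apply, h4]
          simp
      _ = 0 := by simp
  have hMsq : ∀ n, Integrable (fun ω => M n ω ^ 2) μ := fun n => by
    obtain ⟨K, hK⟩ := hMb n
    refine int_of_bdd (K := K ^ 2) (((hMm n).mono (ℱ.le _)).pow 2) fun ω => ?_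
    rw [abs_pow]
    exact pow_le_pow_left₀ (abs_nonneg _) (hK ω) 2
  have hsq : ∀ n, ∫ ω, M n ω ^ 2 ∂μ ≤ C ^ 2 * ∑ k ∈ Finset.range n, w k ^ 2 := by
    intro n
    induction n with
    | zero => simp [hM]
    | succ n ih =>
      have hξsq : ∀ ω, ξ n ω ^ 2 ≤ C ^ 2 := fun ω => by
        rw [← sq_abs (ξ n ω)]
        exact pow_le_pow_left₀ (abs_nonneg _) (hb n ω) 2
      have hMξ : Integrable (fun ω => M n ω * ξ n ω) μ :=
        (hξi n).bdd_mul (c := (hMb n).choose) ((hMm n).mono (ℱ.le _)).aestronglyMeasurable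
          (Eventually.of_forall (hMb n).choose_spec)
      calc ∫ ω, M (n + 1) ω ^ 2 ∂μ
          ≤ ∫ ω, (M n ω ^ 2 + 2 * w n * (M n ω * ξ n ω) + w n ^ 2 * C ^ 2) ∂μ := by
            refine integral_mono (hMsq _)
              (((hMsq n).add (hMξ.const_mul _)).add (integrable_const _)) fun ω => ?_
            simp only [hM, Finset.sum_range_succ]
            have := mul_le_mul_of_nonneg_left (hξsq ω) (sq_nonneg (w n))
            nlinarith
        _ = ∫ ω, M n ω ^ 2 ∂μ + 2 * w n * 0 + w n ^ 2 * C ^ 2 := by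
            have hi : Integrable (fun ω => M n ω ^ 2 + 2 * w n * (M n ω * ξ n ω)) μ :=
              (hMsq n).add (hMξ.const_mul _)
            rw [integral_add hi (integrable_const _),
              integral_add (hMsq n) (hMξ.const_mul _), integral_const_mul, hcross]
            simp
        _ ≤ C ^ 2 * ∑ k ∈ Finset.range (n + 1), w k ^ 2 := by
            rw [Finset.sum_range_succ]
            linarith
  -- The convergence theorem asks for an L¹ bound, obtained from |M| ≤ 1 + M².
  set R : ℝ := 1 + C ^ 2 * ∑' k, w k ^ 2 with hR
  have hbound : ∀ n, eLpNorm (M n) 1 μ ≤ (R.toNNReal : ENNReal) := fun n => by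
    rw [eLpNorm_one_eq_lintegral_enorm, ← ofReal_integral_norm_eq_lintegral_enorm (hMi n)]
    refine ENNReal.ofReal_le_ofReal ?_
    calc ∫ ω, ‖M n ω‖ ∂μ ≤ ∫ ω, (1 + M n ω ^ 2) ∂μ := by
          refine integral_mono (hMi n).norm ((integrable_const _).add (hMsq n)) fun ω => ?_
          simp only [Real.norm_eq_abs]
          nlinarith [sq_nonneg (|M n ω| - 1), sq_abs (M n ω)]
      _ = 1 + ∫ ω, M n ω ^ 2 ∂μ := by
          rw [integral_add (integrable_const _) (hMsq n)]
          simp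
      _ ≤ R := by
          have := hw.sum_le_tsum (Finset.range n) fun k _ => sq_nonneg _
          have := mul_le_mul_of_nonneg_left this (sq_nonneg C)
          linarith [hsq n]
  filter_upwards [hmart.submartingale.ae_tendsto_limitProcess hbound] with ω hω
  exact ⟨_, hω⟩

variable {A : Type*} [Fintype A] [DecidableEq A] {S : A → Type*} [∀ i, Fintype (S i)]
  [∀ i, DecidableEq (S i)]

section

variable {Ω : Type*} {G : A → Profile S → ℝ} {s : ℕ → Ω → Profile S}

lemma measurableSet_history_eq {m n : ℕ} (hm : 1 ≤ m) (hmn : m ≤ n) (a : Profile S) :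
    MeasurableSet[history G s n] {ω | s m ω = a} := by
  have h : MeasurableSpace.comap (fun ω => (s m ω, fun i => G i (s m ω)))
      (MeasurableSpace.prod (⊤ : MeasurableSpace (Profile S))
        (inferInstance : MeasurableSpace (A → ℝ))) ≤ history G s n :=
    le_iSup₂_of_le m (Finset.mem_Icc.2 ⟨hm, hmn⟩) le_rfl
  refine h _ ?_
  refine ⟨Prod.fst ⁻¹' {a}, ?_, rfl⟩
  exact (@measurable_fst _ _ ⊤ _) (MeasurableSpace.measurableSet_top)

lemma history_mono : Monotone (history G s) := fun _ _ hmn =>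
  biSup_mono fun _ hk => Finset.Icc_subset_Icc_right hmn hk

variable [mΩ : MeasurableSpace Ω]

lemma history_le (hs : ∀ (n : ℕ) (a : Profile S), MeasurableSet {ω | s (n + 1) ω = a}) (n : ℕ) :
    history G s n ≤ mΩ := by
  refine iSup₂_le fun m hm => ?_
  obtain ⟨k, rfl⟩ := Nat.exists_eq_add_of_le' (Finset.mem_Icc.1 hm).1
  rintro _ ⟨t, -, rfl⟩
  have : (fun ω => (s (k + 1) ω, fun i => G i (s (k + 1) ω))) ⁻¹' t
      = ⋃ a ∈ {a : Profile S | (a, fun i => G i a) ∈ t}, {ω | s (k + 1) ω = a} := by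
    ext ω
    simp
  rw [this]
  exact MeasurableSet.biUnion (Set.to_countable _) fun a _ => hs k a

/-- The filtration of histories. -/
noncomputable def historyFiltration (G : A → Profile S → ℝ)
    (hs : ∀ (n : ℕ) (a : Profile S), MeasurableSet {ω | s (n + 1) ω = a}) : Filtration ℕ mΩ where
  seq := history G s
  mono' := history_mono
  le' := history_le hs

variable {μ : Measure Ω} [IsProbabilityMeasure μ] {β : A → ℝ} {x : ℕ → Ω → State S}

lemma prod_logit_nonneg [∀ i, Nonempty (S i)] (β : A → ℝ) (x : State S) (a : Profile S) :
    0 ≤ ∏ i, logit β x i (a i) :=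
  Finset.prod_nonneg fun i _ => (logit_pos β x i (a i)).le

lemma prod_logit_le_one [∀ i, Nonempty (S i)] (β : A → ℝ) (x : State S) (a : Profile S) :
    ∏ i, logit β x i (a i) ≤ 1 :=
  Finset.prod_le_one (fun i _ => (logit_pos β x i (a i)).le) fun i _ => logit_le_one β x i (a i)

/-- The difference between what is played and what is expected, with predictable weights. -/
lemma ae_exists_tendsto_noise [∀ i, Nonempty (S i)] (h : IsPlay μ G β s x)
    (hx : ∀ n, Measurable[history G s n] (x n)) {c : ℕ → Ω → Profile S → ℝ} {C : ℝ}
    (hc : ∀ n a, StronglyMeasurable[history G s n] fun ω => c n ω a)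
    (hC : ∀ n ω a, |c n ω a| ≤ C) {δ : ℝ} (hδ : δ < 1 / 2) :
    ∀ᵐ ω ∂μ, ∃ l, Tendsto (fun n => ∑ k ∈ Finset.range n, ((k : ℝ) + 1) ^ (δ - 1) *
      (c k ω (s (k + 1) ω) - ∑ a, c k ω a * ∏ i, logit β (x k ω) i (a i))) atTop (𝓝 l) := by
  classical
  set ℱ := historyFiltration G h.measurableSet_eq with hℱ
  -- The exponent 2(δ - 1) is below -1 exactly when δ < 1/2: this is the source of the limit 1/2 on
  -- the rates.
  have hw : Summable fun n : ℕ => (((n : ℝ) + 1) ^ (δ - 1)) ^ 2 := by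
    have h1 : Summable fun n : ℕ => ((n + 1 : ℕ) : ℝ) ^ (2 * (δ - 1)) :=
      (summable_nat_add_iff 1).2 (Real.summable_nat_rpow.2 (by linarith))
    refine h1.congr fun n => ?_
    rw [← Real.rpow_natCast, ← Real.rpow_mul (by positivity)]
    push_cast
    rw [mul_comm]
  have hpm : ∀ n (a : Profile S), StronglyMeasurable[history G s n]
      fun ω => ∏ i, logit β (x n ω) i (a i) := fun n a => by
    have hcont : Continuous fun y : State S => ∏ i, logit β y i (a i) :=
      continuous_finsetProd _ fun i _ => continuous_logit β i (a i)
    exact (hcont.measurable.comp (hx n)).stronglyMeasurable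
  have hind : ∀ n (a : Profile S), StronglyMeasurable[history G s (n + 1)]
      ({ω | s (n + 1) ω = a}.indicator fun _ => (1 : ℝ)) := fun n a =>
    stronglyMeasurable_const.indicator (measurableSet_history_eq (by omega) le_rfl a)
  -- Split by the profile played: for fixed `a`, the indicator minus its conditional probability is
  -- a martingale difference, and the predictable weight `c` factors out of the conditional
  -- expectation. Finitely many `a` are summed afterwards.
  have key : ∀ a : Profile S, ∀ᵐ ω ∂μ, ∃ l, Tendsto (fun n => ∑ k ∈ Finset.range n,
      ((k : ℝ) + 1) ^ (δ - 1) * (c k ω a * ({ω | s (k + 1) ω = a}.indicator (fun _ => (1 : ℝ)) ω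
        - ∏ i, logit β (x k ω) i (a i)))) atTop (𝓝 l) := by
    intro a
    have hd1 : ∀ n ω, |{ω | s (n + 1) ω = a}.indicator (fun _ => (1 : ℝ)) ω
        - ∏ i, logit β (x n ω) i (a i)| ≤ 1 := fun n ω => by
      have h0 := prod_logit_nonneg β (x n ω) a
      have h1 := prod_logit_le_one β (x n ω) a
      rw [Set.indicator_apply]
      split_ifs <;> rw [abs_le] <;> constructor <;> linarith
    refine ae_exists_tendsto_sum_of_condExp_eq_zero ℱ (C := C * 1) (fun n => ?_) (fun n ω => ?_)
      (fun n => ?_) hw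
    · exact ((hc n a).mono (history_mono n.le_succ)).mul
        ((hind n a).sub ((hpm n a).mono (history_mono n.le_succ)))
    · rw [abs_mul]
      exact mul_le_mul (hC n ω a) (hd1 n ω) (abs_nonneg _) ((abs_nonneg _).trans (hC n ω a))
    · have hi : Integrable ({ω | s (n + 1) ω = a}.indicator fun _ => (1 : ℝ)) μ :=
        (integrable_const _).indicator (h.measurableSet_eq n a)
      have hp : Integrable (fun ω => ∏ i, logit β (x n ω) i (a i)) μ :=
        Integrable.of_bound ((hpm n a).mono (history_le h.measurableSet_eq n)).aestronglyMeasurable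
          1 (Eventually.of_forall fun ω => by
            rw [Real.norm_eq_abs, abs_of_nonneg (prod_logit_nonneg β _ a)]
            exact prod_logit_le_one β _ a)
      have h1 := condExp_stronglyMeasurable_mul_of_bound (history_le h.measurableSet_eq n)
        (hc n a) (hi.sub hp) C (Eventually.of_forall fun ω => hC n ω a)
      have h2 := condExp_sub hi hp (history G s n)
      have h3 : μ[fun ω => ∏ i, logit β (x n ω) i (a i) | history G s n]
          = fun ω => ∏ i, logit β (x n ω) i (a i) :=
        condExp_of_stronglyMeasurable (history_le h.measurableSet_eq n) (hpm n a) hp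
      filter_upwards [h1, h2, h.condLaw n a] with ω g1 g2 g3
      refine g1.trans ?_
      rw [Pi.mul_apply, g2, Pi.sub_apply, h3, g3]
      simp
  filter_upwards [ae_all_iff.2 key] with ω hω
  choose l hl using hω
  refine ⟨∑ a, l a, (tendsto_finsetSum Finset.univ fun a _ => hl a).congr fun n => ?_⟩
  rw [Finset.sum_comm]
  refine Finset.sum_congr rfl fun k _ => ?_
  rw [← Finset.mul_sum]
  congr 1
  simp only [mul_sub, Finset.sum_sub_distrib]
  congr 1
  simp [Set.indicator_apply]

end

end LearningGame

namespace LearningGame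

/-! ### Norms adapted to a stable matrix -/

section AdaptedNorm

open scoped Matrix.Norms.Operator Matrix

variable {ι : Type*} [Fintype ι] [DecidableEq ι]

/-- To first order in ε, the square of ‖1 + εz‖ is 1 + 2ε Re z, against 1 - 2εc on the right. There
are finitely many eigenvalues, so one small ε serves them all. -/
lemma exists_norm_one_add_mul_lt (B : Matrix ι ι ℂ) {c : ℝ}
    (hB : ∀ z, Module.End.HasEigenvalue (Matrix.toLin' B) z → z.re < -c) :
    ∃ ε : ℝ, 0 < ε ∧ 0 < 1 - ε * c ∧
      ∀ z, Module.End.HasEigenvalue (Matrix.toLin' B) z → ‖1 + (ε : ℂ) * z‖ < 1 - ε * c := by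
  have h1 : ∀ᶠ ε : ℝ in 𝓝[>] 0, 0 < 1 - ε * c := by
    have : Tendsto (fun ε : ℝ => 1 - ε * c) (𝓝[>] 0) (𝓝 (1 - 0 * c)) :=
      (tendsto_nhdsWithin_of_tendsto_nhds tendsto_id).mul_const c |>.const_sub 1
    exact (tendsto_order.1 this).1 0 (by simp)
  have h2 : ∀ z ∈ {z | Module.End.HasEigenvalue (Matrix.toLin' B) z}, ∀ᶠ ε : ℝ in 𝓝[>] 0,
      ‖1 + (ε : ℂ) * z‖ < 1 - ε * c := by
    intro z hz
    have hz' := hB z hz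
    have : Tendsto (fun ε : ℝ => ε * (‖z‖ ^ 2 - c ^ 2)) (𝓝[>] 0) (𝓝 (0 * (‖z‖ ^ 2 - c ^ 2))) :=
      (tendsto_nhdsWithin_of_tendsto_nhds tendsto_id).mul_const _
    have h3 := (tendsto_order.1 this).2 (2 * (-c - z.re)) (by linarith)
    filter_upwards [h1, h3, self_mem_nhdsWithin] with ε h4 h5 h6
    refine lt_of_pow_lt_pow_left₀ 2 h4.le ?_
    have hε : (0 : ℝ) < ε := h6
    have e1 : ‖1 + (ε : ℂ) * z‖ ^ 2 = 1 + 2 * ε * z.re + ε ^ 2 * ‖z‖ ^ 2 := by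
      rw [Complex.sq_norm, Complex.sq_norm, Complex.normSq_apply, Complex.normSq_apply]
      simp
      ring
    rw [e1]
    nlinarith [mul_lt_mul_of_pos_left h5 hε]
  have h3 := (eventually_all_finite
    (Module.End.finite_hasEigenvalue (Matrix.toLin' B))).2 h2
  obtain ⟨ε, ⟨h4, h5⟩, h6⟩ := ((h1.and h3).and self_mem_nhdsWithin).exists
  exact ⟨ε, h6, h4, h5⟩

/-- Gelfand's formula: the m-th roots of the norms of the powers tend to the spectral radius, which
is below `r`. -/
lemma exists_norm_pow_le [Nonempty ι] (M : Matrix ι ι ℂ) {r : ℝ} (hr : 0 < r)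
    (hM : ∀ z, Module.End.HasEigenvalue (Matrix.toLin' M) z → ‖z‖ < r) :
    ∃ m : ℕ, m ≠ 0 ∧ ‖M ^ m‖ ≤ r ^ m := by
  have h1 : spectralRadius ℂ M < (r.toNNReal : ENNReal) := by
    refine spectrum.spectralRadius_lt_of_forall_lt M fun z hz => ?_
    rw [← Matrix.spectrum_toLin'] at hz
    have := hM z (Module.End.hasEigenvalue_iff_mem_spectrum.2 hz)
    rwa [← NNReal.coe_lt_coe, coe_nnnorm, Real.coe_toNNReal _ hr.le]
  have h2 := (tendsto_order.1 (spectrum.pow_nnnorm_pow_one_div_tendsto_nhds_spectralRadius M)).2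
    _ h1
  obtain ⟨m, h3, h4⟩ := (h2.and (eventually_ge_atTop 1)).exists
  have hm : (0 : ℝ) < m := by exact_mod_cast h4
  refine ⟨m, by omega, ?_⟩
  have h5 := ENNReal.rpow_le_rpow h3.le hm.le
  rw [← ENNReal.rpow_mul, one_div, inv_mul_cancel₀ hm.ne', ENNReal.rpow_one,
    ENNReal.rpow_natCast, ← ENNReal.coe_pow, ENNReal.coe_le_coe, ← NNReal.coe_le_coe] at h5
  simpa [Real.coe_toNNReal _ hr.le] using h5

/-- If all eigenvalues of an endomorphism have real part less than `-c`, then its Euler steps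
contract at rate `c` in a suitable norm. -/
lemma exists_adapted_seminorm [Nonempty ι] {E : Type*} [NormedAddCommGroup E] [NormedSpace ℝ E]
    (B : Matrix ι ι ℂ) (φ : E →ₗ[ℝ] (ι → ℂ)) (hφ : ∀ v, ‖φ v‖ = ‖v‖) (D : E →ₗ[ℝ] E)
    (hD : ∀ v, φ (D v) = B *ᵥ φ v) {c : ℝ}
    (hB : ∀ z, Module.End.HasEigenvalue (Matrix.toLin' B) z → z.re < -c) :
    ∃ (p : Seminorm ℝ E) (K ε : ℝ), 0 < ε ∧ (∀ v, ‖v‖ ≤ p v) ∧ (∀ v, p v ≤ K * ‖v‖) ∧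
      ∀ t, 0 ≤ t → t ≤ ε → ∀ v, p (v + t • D v) ≤ (1 - c * t) * p v := by
  obtain ⟨ε, hε, hεc, hz⟩ := exists_norm_one_add_mul_lt B hB
  set r := 1 - ε * c with hr
  set M : Matrix ι ι ℂ := 1 + (ε : ℂ) • B with hMdef
  have hM : ∀ z, Module.End.HasEigenvalue (Matrix.toLin' M) z → ‖z‖ < r := by
    intro z hzM
    obtain ⟨v, hv⟩ := hzM.exists_hasEigenvector
    have h1 : v + (ε : ℂ) • B *ᵥ v = z • v := by
      have := hv.apply_eq_smul
      rwa [Matrix.toLin'_apply, hMdef, Matrix.add_mulVec, Matrix.one_mulVec,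
        Matrix.smul_mulVec] at this
    have hε' : (ε : ℂ) ≠ 0 := by exact_mod_cast hε.ne'
    have h2 : Module.End.HasEigenvalue (Matrix.toLin' B) ((z - 1) / ε) := by
      refine Module.End.hasEigenvalue_of_hasEigenvector (x := v)
        ⟨Module.End.mem_eigenspace_iff.2 ?_, hv.2⟩
      have h3 : (ε : ℂ) • B *ᵥ v = (z - 1) • v := by
        rw [sub_smul, one_smul, ← h1, add_sub_cancel_left]
      rw [Matrix.toLin'_apply, div_eq_inv_mul, mul_smul, ← h3, smul_smul, inv_mul_cancel₀ hε',
        one_smul]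
    have h3 := hz _ h2
    rwa [mul_div_cancel₀ _ hε', add_sub_cancel] at h3
  obtain ⟨m, hm0, hm⟩ := exists_norm_pow_le M hεc hM
  have hq : ∀ (k : ℕ) (v : E), ‖(M ^ k) *ᵥ φ v‖ ≤ ‖M ^ k‖ * ‖v‖ := fun k v => by
    rw [← hφ v]
    exact Matrix.linfty_opNorm_mulVec _ _
  -- Applying `M` shifts this sum by one index and gains a factor `r`. The new term k = m is at most
  -- the lost term k = 0 because ‖M^m‖ ≤ r^m.
  let f : E → ℝ := fun v => ∑ k ∈ Finset.range m, (r⁻¹) ^ k * ‖(M ^ k) *ᵥ φ v‖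
  have hf : ∀ v, f v = ∑ k ∈ Finset.range m, (r⁻¹) ^ k * ‖(M ^ k) *ᵥ φ v‖ := fun v => rfl
  have hri : 0 < r⁻¹ := inv_pos.2 hεc
  let p : Seminorm ℝ E := Seminorm.of f
    (fun v w => by
      simp only [hf, ← Finset.sum_add_distrib, ← mul_add]
      refine Finset.sum_le_sum fun k _ => mul_le_mul_of_nonneg_left ?_ (pow_pos hri k).le
      rw [map_add, Matrix.mulVec_add]
      exact norm_add_le _ _)
    (fun a v => by
      simp only [hf, Finset.mul_sum]
      refine Finset.sum_congr rfl fun k _ => ?_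
      rw [map_smul, Matrix.mulVec_smul, norm_smul]
      ring)
  have hp : ∀ v, p v = f v := fun v => rfl
  have hstep : ∀ v, p (v + ε • D v) ≤ r * p v := by
    intro v
    have h1 : φ (v + ε • D v) = M *ᵥ φ v := by
      rw [map_add, map_smul, hD, hMdef, Matrix.add_mulVec, Matrix.one_mulVec, Matrix.smul_mulVec]
      rfl
    rw [hp, hp, hf, hf, h1]
    simp only [Matrix.mulVec_mulVec, ← pow_succ]
    have h2 : ∀ k, (r⁻¹) ^ k * ‖(M ^ (k + 1)) *ᵥ φ v‖
        = r * ((r⁻¹) ^ (k + 1) * ‖(M ^ (k + 1)) *ᵥ φ v‖) := fun k => by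
      have h3 : r * r⁻¹ = 1 := mul_inv_cancel₀ hεc.ne'
      rw [pow_succ (r⁻¹)]
      linear_combination -((r⁻¹) ^ k * ‖(M ^ (k + 1)) *ᵥ φ v‖) * h3
    simp only [h2, ← Finset.mul_sum]
    refine mul_le_mul_of_nonneg_left ?_ hεc.le
    have h3 := Finset.sum_range_succ (fun k => (r⁻¹) ^ k * ‖(M ^ k) *ᵥ φ v‖) m
    rw [Finset.sum_range_succ'] at h3
    have h4 : (r⁻¹) ^ m * ‖(M ^ m) *ᵥ φ v‖ ≤ (r⁻¹) ^ 0 * ‖(M ^ 0) *ᵥ φ v‖ := by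
      rw [pow_zero, pow_zero, Matrix.one_mulVec, one_mul, hφ, inv_pow,
        inv_mul_le_iff₀ (pow_pos hεc m)]
      exact (hq m v).trans (mul_le_mul_of_nonneg_right hm (norm_nonneg _))
    linarith
  refine ⟨p, ∑ k ∈ Finset.range m, (r⁻¹) ^ k * ‖M ^ k‖, ε, hε, fun v => ?_, fun v => ?_,
    fun t ht0 htε v => ?_⟩
  · have h1 := Finset.single_le_sum (f := fun k => (r⁻¹) ^ k * ‖(M ^ k) *ᵥ φ v‖)
      (fun k _ => mul_nonneg (pow_pos hri k).le (norm_nonneg _))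
      (Finset.mem_range.2 (Nat.pos_of_ne_zero hm0))
    rw [hp, hf]
    simpa [hφ] using h1
  · rw [hp, hf, Finset.sum_mul]
    refine Finset.sum_le_sum fun k _ => ?_
    rw [mul_assoc]
    exact mul_le_mul_of_nonneg_left (hq k v) (pow_pos hri k).le
  -- A shorter step is a convex combination of the identity and the full step ε, and (1 - t/ε) +
  -- (t/ε)(1 - εc) = 1 - ct.
  · have h1 : v + t • D v = (1 - t / ε) • v + (t / ε) • (v + ε • D v) := by
      rw [smul_add, smul_smul, div_mul_cancel₀ _ hε.ne', ← add_assoc, ← add_smul, sub_add_cancel,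
        one_smul]
    have h2 : t / ε ≤ 1 := (div_le_one hε).2 htε
    have h3 : 0 ≤ t / ε := div_nonneg ht0 hε.le
    rw [h1]
    refine (map_add_le_add p _ _).trans ?_
    rw [map_smul_eq_mul, map_smul_eq_mul, Real.norm_of_nonneg h3,
      Real.norm_of_nonneg (sub_nonneg.2 h2)]
    calc (1 - t / ε) * p v + t / ε * p (v + ε • D v)
        ≤ (1 - t / ε) * p v + t / ε * (r * p v) := by
          have := mul_le_mul_of_nonneg_left (hstep v) h3
          linarith
      _ = (1 - c * t) * p v := by
          rw [hr]; field_simp; ring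

end AdaptedNorm

end LearningGame

namespace LearningGame

variable {A : Type*} [Fintype A] [DecidableEq A] {S : A → Type*} [∀ i, Fintype (S i)]
  [∀ i, DecidableEq (S i)]

/-! ### The Jacobian at the rest point -/

lemma hasDerivAt_apply_line {H : State S → State S} (hH : Differentiable ℝ H) (x v : State S)
    (i : A) (r : S i) :
    HasDerivAt (fun t : ℝ => H (x + t • v) i r) (fderiv ℝ H x v i r) 0 := by
  have h1 : HasDerivAt (fun t : ℝ => x + t • v) v 0 := by
    simpa using ((hasDerivAt_id (0 : ℝ)).smul_const v).const_add x
  have h2 : HasFDerivAt H (fderiv ℝ H x) (x + (0 : ℝ) • v) := by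
    simpa using (hH x).hasFDerivAt
  have h3 := h2.comp_hasDerivAt (0 : ℝ) h1
  exact hasDerivAt_pi.1 (hasDerivAt_pi.1 h3 i) r

/-- The coordinate vectors of the state space. -/
def unitState (q : Σ i, S i) : State S := Pi.single q.1 (Pi.single q.2 1)

lemma unitState_apply (q : Σ i, S i) (i : A) (r : S i) :
    unitState q i r = if q = ⟨i, r⟩ then 1 else 0 := by
  obtain ⟨j, u⟩ := q
  by_cases hij : i = j
  · subst hij
    by_cases hr : r = u
    · subst hr; simp [unitState]
    · have : u ≠ r := fun h => hr h.symm
      simp [unitState, hr, this]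
  · have : ¬ j = i := fun h => hij h.symm
    simp [unitState, hij, this]

lemma sum_smul_unitState (v : State S) : ∑ q : Σ i, S i, v q.1 q.2 • unitState q = v := by
  ext i r
  simp only [Finset.sum_apply, Pi.smul_apply, unitState_apply, smul_eq_mul, mul_ite, mul_one,
    mul_zero]
  rw [Finset.sum_ite_eq' Finset.univ (⟨i, r⟩ : Σ i, S i) fun q => v q.1 q.2]
  simp

lemma jacobian_apply (H : State S → State S) (x : State S) (p q : Σ i, S i) :
    jacobian H x p q = fderiv ℝ H x (unitState q) p.1 p.2 := rfl

section

variable [∀ i, Nonempty (S i)]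

/-- In the product rule the derivative of the logit factor is multiplied by `logitPayoff G β x - x`,
which vanishes at a fixed point. -/
lemma fderiv_Phi_apply (G : A → Profile S → ℝ) (β : A → ℝ) {x : State S}
    (hx : logitPayoff G β x = x) (v : State S) (i : A) (r : S i) :
    fderiv ℝ (Phi G β) x v i r
      = logit β x i r * (fderiv ℝ (logitPayoff G β) x v i r - v i r) := by
  have h1 := hasDerivAt_apply_line (differentiable_Phi G β) x v i r
  have h2 := hasDerivAt_apply_line (differentiable_logitPayoff G β) x v i r
  have h3 : HasDerivAt (fun t : ℝ => (x + t • v) i r) (v i r) 0 := by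
    simpa using ((hasDerivAt_id (0 : ℝ)).mul_const (v i r)).const_add (x i r)
  have h4 : DifferentiableAt ℝ (fun t : ℝ => logit β (x + t • v) i r) 0 := by
    have h5 : Differentiable ℝ fun t : ℝ => x + t • v := by fun_prop
    exact ((differentiable_logit β i r).comp h5) 0
  have h6 := h4.hasDerivAt.mul (h2.sub h3)
  have h7 := h1.unique h6
  rw [h7]
  simp [hx]

lemma jacobian_Phi_apply (G : A → Profile S → ℝ) (β : A → ℝ) {x : State S}
    (hx : logitPayoff G β x = x) (p q : Σ i, S i) :
    jacobian (Phi G β) x p q = logit β x p.1 p.2 *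
      (fderiv ℝ (logitPayoff G β) x (unitState q) p.1 p.2 - if p = q then 1 else 0) := by
  rw [jacobian_apply, fderiv_Phi_apply G β hx, unitState_apply]
  congr 2
  exact if_congr eq_comm rfl rfl

lemma fderiv_logitPayoff_self (G : A → Profile S → ℝ) (β : A → ℝ) (x : State S) (i : A)
    (q r : S i) : fderiv ℝ (logitPayoff G β) x (unitState ⟨i, q⟩) i r = 0 := by
  have h1 := hasDerivAt_apply_line (differentiable_logitPayoff G β) x (unitState ⟨i, q⟩) i r
  have h2 : ∀ t : ℝ, logitPayoff G β (x + t • unitState ⟨i, q⟩) i r = logitPayoff G β x i r := by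
    intro t
    have h3 : x + t • unitState ⟨i, q⟩ = Function.update x i (x i + t • Pi.single q 1) := by
      ext k u
      by_cases hk : k = i
      · subst hk; simp [unitState]
      · simp [unitState, hk]
    rw [h3, logitPayoff_update_self]
  simp only [h2] at h1
  exact h1.unique (hasDerivAt_const _ _)

lemma logit_of_subsingleton (β : A → ℝ) (x : State S) (i : A) [Subsingleton (S i)] (r : S i) :
    logit β x i r = 1 := by
  have h := sum_logit β x i
  rwa [Fintype.sum_subsingleton _ r] at h

/-- A player with a single strategy plays it whatever the perceptions are. The Jacobian is therefore
block triangular for the splitting into players with and without a choice. -/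
lemma fderiv_logitPayoff_of_subsingleton (G : A → Profile S → ℝ) (β : A → ℝ) (x : State S)
    (j : A) (hj : Subsingleton (S j)) (q : S j) (i : A) (r : S i) :
    fderiv ℝ (logitPayoff G β) x (unitState ⟨j, q⟩) i r = 0 := by
  have h1 := hasDerivAt_apply_line (differentiable_logitPayoff G β) x (unitState ⟨j, q⟩) i r
  have h2 : ∀ t : ℝ, logitPayoff G β (x + t • unitState ⟨j, q⟩) i r = logitPayoff G β x i r := by
    intro t
    have h3 : logit β (x + t • unitState ⟨j, q⟩) = logit β x := by
      ext k u
      by_cases hk : k = j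
      · subst hk
        rw [logit_of_subsingleton, logit_of_subsingleton]
      · refine congrFun (logit_congr β ?_) u
        simp [unitState, hk]
    simp only [logitPayoff, h3]
  simp only [h2] at h1
  exact h1.unique (hasDerivAt_const _ _)

/-- The rows of the derivative of a Lipschitz map are bounded in `ℓ¹`. -/
lemma sum_abs_fderiv_logitPayoff_le [Nonempty A] (G : A → Profile S → ℝ) (β : A → ℝ)
    (hβ : ∀ i, 0 < β i) (x : State S) (i : A) (r : S i) :
    ∑ q : Σ i, S i, |fderiv ℝ (logitPayoff G β) x (unitState q) i r| ≤ eta G * alpha β := by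
  have h0 : 0 ≤ eta G * alpha β := mul_nonneg (eta_nonneg G) (alpha_nonneg β hβ)
  have hL : LipschitzWith ⟨eta G * alpha β, h0⟩ (logitPayoff G β) :=
    LipschitzWith.of_dist_le_mul fun x y => by
      rw [dist_eq_norm, dist_eq_norm]
      exact norm_logitPayoff_sub_le G β hβ x y
  have hn : ‖fderiv ℝ (logitPayoff G β) x‖ ≤ eta G * alpha β := norm_fderiv_le_of_lipschitz ℝ hL
  set d : (Σ i, S i) → ℝ := fun q => fderiv ℝ (logitPayoff G β) x (unitState q) i r with hd
  -- Testing the derivative on the sign vector of its row turns the sup-norm operator bound into an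
  -- ℓ¹ bound on that row.
  set v : State S := fun j u => SignType.sign (d ⟨j, u⟩) with hv
  have hv1 : ‖v‖ ≤ 1 := by
    refine (pi_norm_le_iff_of_nonneg zero_le_one).2 fun j =>
      (pi_norm_le_iff_of_nonneg zero_le_one).2 fun u => ?_
    simp only [hv]
    rcases lt_trichotomy (d ⟨j, u⟩) 0 with h | h | h <;> simp [h]
  have h1 : fderiv ℝ (logitPayoff G β) x v i r = ∑ q, |d q| := by
    conv_lhs => rw [← sum_smul_unitState v, map_sum]
    simp only [Finset.sum_apply, map_smul, Pi.smul_apply, smul_eq_mul]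
    exact Finset.sum_congr rfl fun q _ => sign_mul_self _
  rw [← h1]
  calc fderiv ℝ (logitPayoff G β) x v i r ≤ |fderiv ℝ (logitPayoff G β) x v i r| := le_abs_self _
    _ ≤ ‖fderiv ℝ (logitPayoff G β) x v‖ := abs_apply_le_norm _ i r
    _ ≤ ‖fderiv ℝ (logitPayoff G β) x‖ * ‖v‖ := ContinuousLinearMap.le_opNorm _ _
    _ ≤ eta G * alpha β * 1 := mul_le_mul hn hv1 (norm_nonneg _) h0
    _ = eta G * alpha β := mul_one _

/-- Gershgorin: row (i, r) is σ(d - 1) on the diagonal and σd elsewhere, with ∑|d| ≤ `eta G * alpha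
β` < 1 and σ > 0, so every disc lies in the open left half-plane. -/
lemma re_eigenvalue_neg [Nonempty A] (G : A → Profile S → ℝ) (β : A → ℝ) (hβ : ∀ i, 0 < β i)
    (hL : eta G * alpha β < 1) {x : State S} (hx : logitPayoff G β x = x) {z : ℂ}
    (hz : Module.End.HasEigenvalue
      (Matrix.toLin' ((jacobian (Phi G β) x).map fun b : ℝ => (b : ℂ))) z) : z.re < 0 := by
  obtain ⟨⟨i, r⟩, hp⟩ := eigenvalue_mem_ball hz
  set d : (Σ i, S i) → ℝ := fun q => fderiv ℝ (logitPayoff G β) x (unitState q) i r with hd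
  have hσ := logit_pos β x i r
  have hsum := sum_abs_fderiv_logitPayoff_le G β hβ x i r
  rw [← Finset.add_sum_erase _ _ (Finset.mem_univ (⟨i, r⟩ : Σ i, S i))] at hsum
  have hdiag : jacobian (Phi G β) x ⟨i, r⟩ ⟨i, r⟩ = logit β x i r * (d ⟨i, r⟩ - 1) := by
    simp [jacobian_Phi_apply G β hx, hd]
  have hoff : ∑ q ∈ Finset.univ.erase (⟨i, r⟩ : Σ i, S i),
      ‖((jacobian (Phi G β) x).map fun b : ℝ => (b : ℂ)) ⟨i, r⟩ q‖
      = logit β x i r * ∑ q ∈ Finset.univ.erase (⟨i, r⟩ : Σ i, S i), |d q| := by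
    rw [Finset.mul_sum]
    refine Finset.sum_congr rfl fun q hq => ?_
    have hq' : ¬ (⟨i, r⟩ : Σ i, S i) = q := fun h => (Finset.mem_erase.1 hq).1 h.symm
    rw [Matrix.map_apply, Complex.norm_real, jacobian_Phi_apply G β hx, if_neg hq', sub_zero,
      norm_mul, Real.norm_eq_abs, abs_of_pos hσ, Real.norm_eq_abs]
  rw [Metric.mem_closedBall, Complex.dist_eq, hoff, Matrix.map_apply, hdiag] at hp
  have h1 := (Complex.re_le_norm _).trans hp
  rw [Complex.sub_re, Complex.ofReal_re] at h1
  have h2 := le_abs_self (d ⟨i, r⟩)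
  have h3 : d ⟨i, r⟩ + ∑ q ∈ Finset.univ.erase (⟨i, r⟩ : Σ i, S i), |d q| < 1 := by linarith
  nlinarith

end

/-! ### Spectral abscissa and block triangular matrices -/

lemma finite_re_eigenvalues {ι : Type*} [Fintype ι] [DecidableEq ι] (B : Matrix ι ι ℝ) :
    {t | ∃ z : ℂ, Module.End.HasEigenvalue (Matrix.toLin' (B.map (fun b : ℝ => (b : ℂ)))) z ∧
      t = z.re}.Finite := by
  refine ((Module.End.finite_hasEigenvalue
    (Matrix.toLin' (B.map (fun b : ℝ => (b : ℂ))))).image Complex.re).subset ?_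
  rintro t ⟨z, hz, rfl⟩
  exact ⟨z, hz, rfl⟩

lemma re_le_rho {ι : Type*} [Fintype ι] [DecidableEq ι] (B : Matrix ι ι ℝ) {z : ℂ}
    (hz : Module.End.HasEigenvalue (Matrix.toLin' (B.map (fun b : ℝ => (b : ℂ)))) z) :
    z.re ≤ rho B :=
  le_csSup (finite_re_eigenvalues B).bddAbove ⟨z, hz, rfl⟩

lemma exists_re_eq_rho {ι : Type*} [Fintype ι] [DecidableEq ι] [Nonempty ι] (B : Matrix ι ι ℝ) :
    ∃ z : ℂ, Module.End.HasEigenvalue (Matrix.toLin' (B.map (fun b : ℝ => (b : ℂ)))) z ∧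
      rho B = z.re := by
  obtain ⟨z, hz⟩ := Module.End.exists_eigenvalue (Matrix.toLin' (B.map (fun b : ℝ => (b : ℂ))))
  exact Set.Nonempty.csSup_mem (s := {t | ∃ z : ℂ, Module.End.HasEigenvalue
    (Matrix.toLin' (B.map (fun b : ℝ => (b : ℂ)))) z ∧ t = z.re}) ⟨z.re, z, hz, rfl⟩
    (finite_re_eigenvalues B)

lemma hasEigenvalue_toLin'_iff_det {ι : Type*} [Fintype ι] [DecidableEq ι] (B : Matrix ι ι ℂ)
    (z : ℂ) : Module.End.HasEigenvalue (Matrix.toLin' B) z ↔ (Matrix.scalar ι z - B).det = 0 := by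
  rw [Module.End.hasEigenvalue_iff_mem_spectrum, Matrix.spectrum_toLin',
    Matrix.mem_spectrum_iff_isRoot_charpoly, Polynomial.IsRoot, Matrix.eval_charpoly]

/-- The largest real part of an eigenvalue is at least the average of the diagonal over a block of
a block triangular matrix. -/
lemma sum_diag_le_card_mul_rho {ι : Type*} [Fintype ι] [DecidableEq ι] (B : Matrix ι ι ℝ)
    (P : ι → Prop) [DecidablePred P] (hB : ∀ p, P p → ∀ q, ¬ P q → B p q = 0) :
    ∑ p : {p // P p}, B p p ≤ Fintype.card {p // P p} * rho B := by
  set B' : Matrix {p // P p} {p // P p} ℂ :=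
    (B.map (fun b : ℝ => (b : ℂ))).toSquareBlockProp P with hB'
  -- The determinant factors over the blocks, so eigenvalues of the diagonal block are eigenvalues
  -- of `B`.
  have hroot : ∀ z ∈ B'.charpoly.roots, z.re ≤ rho B := by
    intro z hz
    refine re_le_rho B ((hasEigenvalue_toLin'_iff_det _ z).2 ?_)
    have h1 : (Matrix.scalar _ z - B').det = 0 := by
      rw [← Matrix.eval_charpoly]
      exact Polynomial.isRoot_of_mem_roots hz
    rw [Matrix.twoBlockTriangular_det' _ P]
    · have h2 : (Matrix.scalar ι z - B.map (fun b : ℝ => (b : ℂ))).toSquareBlockProp P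
          = Matrix.scalar _ z - B' := by
        ext p q
        simp [hB', Matrix.toSquareBlockProp_def, Matrix.diagonal_apply, Subtype.ext_iff]
      rw [h2, h1, zero_mul]
    · intro p hp q hq
      have : p ≠ q := fun h => hq (h ▸ hp)
      simp [this, hB p hp q hq]
  -- The trace of the block is the sum of its eigenvalues, and each real part is at most `rho B`.
  have htr : ∑ p : {p // P p}, B p p = (B'.charpoly.roots.map Complex.re).sum := by
    have h1 := congrArg Complex.re (Matrix.trace_eq_sum_roots_charpoly B')
    have h2 : (B'.charpoly.roots.sum).re = (B'.charpoly.roots.map Complex.re).sum :=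
      map_multiset_sum Complex.reAddGroupHom _
    rw [← h2, ← h1, Matrix.trace, Complex.re_sum]
    exact Finset.sum_congr rfl fun p _ => by simp [hB', Matrix.toSquareBlockProp_def]
  rw [htr]
  have hcard : Multiset.card B'.charpoly.roots = Fintype.card {p // P p} := by
    rw [IsAlgClosed.card_roots_eq_natDegree, Matrix.charpoly_natDegree_eq_dim]
  have h3 := Multiset.sum_le_card_nsmul (B'.charpoly.roots.map Complex.re) (rho B) (by
    intro t ht
    obtain ⟨z, hz, rfl⟩ := Multiset.mem_map.1 ht
    exact hroot z hz)
  rwa [Multiset.card_map, hcard, nsmul_eq_mul] at h3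

section

variable [∀ i, Nonempty (S i)]

lemma rho_jacobian_neg [Nonempty A] (G : A → Profile S → ℝ) (β : A → ℝ) (hβ : ∀ i, 0 < β i)
    (hL : eta G * alpha β < 1) {x : State S} (hx : logitPayoff G β x = x) :
    rho (jacobian (Phi G β) x) < 0 := by
  have : Nonempty (Σ i, S i) := by
    obtain ⟨i⟩ := ‹Nonempty A›
    exact ⟨⟨i, Classical.arbitrary _⟩⟩
  obtain ⟨z, hz, h⟩ := exists_re_eq_rho (jacobian (Phi G β) x)
  rw [h]
  exact re_eigenvalue_neg G β hβ hL hx hz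

/-- If some player has a choice, the slowest mode has rate at most `1 / 2`. -/
lemma neg_half_le_rho_jacobian (G : A → Profile S → ℝ) (β : A → ℝ) {x : State S}
    (hx : logitPayoff G β x = x) (hS : ∃ i, ¬ Subsingleton (S i)) :
    -(1 / 2) ≤ rho (jacobian (Phi G β) x) := by
  classical
  set P : (Σ i, S i) → Prop := fun p => ¬ Subsingleton (S p.1) with hP
  have h1 := sum_diag_le_card_mul_rho (jacobian (Phi G β) x) P (fun p hp q hq => by
    have hpq : p ≠ q := fun h => hq (h ▸ hp)
    obtain ⟨j, u⟩ := q
    rw [jacobian_Phi_apply G β hx, if_neg hpq,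
      fderiv_logitPayoff_of_subsingleton G β x j (not_not.1 hq), sub_zero, mul_zero])
  have h2 : ∑ p : {p // P p}, jacobian (Phi G β) x p p
      = ∑ p : {p // P p}, -logit β x p.1.1 p.1.2 := by
    refine Finset.sum_congr rfl fun p _ => ?_
    obtain ⟨⟨i, r⟩, hp⟩ := p
    rw [jacobian_Phi_apply G β hx, fderiv_logitPayoff_self]
    simp
  have h3 : ∀ f : (i : A) → S i → ℝ, ∑ p : {p // P p}, f p.1.1 p.1.2
      = ∑ i ∈ Finset.univ.filter fun i => ¬ Subsingleton (S i), ∑ r, f i r := by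
    intro f
    rw [← Finset.sum_subtype (Finset.univ.filter P) (by simp) fun p => f p.1 p.2,
      Finset.sum_filter, Fintype.sum_sigma, Finset.sum_filter]
    refine Finset.sum_congr rfl fun i _ => ?_
    by_cases hi : Subsingleton (S i) <;> simp [hi]
  have h4 : (Fintype.card {p // P p} : ℝ)
      = ∑ i ∈ Finset.univ.filter fun i => ¬ Subsingleton (S i), (Fintype.card (S i) : ℝ) := by
    have := h3 fun _ _ => 1
    simpa using this
  -- Each of the `m` players with a choice contributes -1 to the trace, as the diagonal entries are
  -- minus the logit probabilities, and at least two rows. Thus -m ≤ N ρ with N ≥ 2m rows, whence ρ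
  -- ≥ -1/2.
  set m := (Finset.univ.filter fun i => ¬ Subsingleton (S i)).card with hm
  have h5 : (2 : ℝ) * m ≤ Fintype.card {p // P p} := by
    rw [h4, hm, mul_comm, ← nsmul_eq_mul]
    refine Finset.card_nsmul_le_sum _ _ _ fun i hi => ?_
    have : 1 < Fintype.card (S i) := by
      rw [← not_le, Fintype.card_le_one_iff_subsingleton]
      exact (Finset.mem_filter.1 hi).2
    exact_mod_cast this
  have hm0 : (0 : ℝ) < m := by
    obtain ⟨i, hi⟩ := hS
    exact_mod_cast Finset.card_pos.2 ⟨i, by simp [hi]⟩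
  rw [h2, h3 fun i r => -logit β x i r] at h1
  simp only [Finset.sum_neg_distrib, sum_logit, Finset.sum_const, nsmul_eq_mul, mul_one] at h1
  rw [← hm] at h1
  by_contra hlt
  rw [not_le] at hlt
  nlinarith

end

end LearningGame

namespace LearningGame

/-! ### Rate of convergence of a stochastic approximation near a stable zero -/

/-- The unknown is `W n`, the rescaled deviation plus the tail `T n` of the weighted noise series.
Rescaling expands by about 1 + δ/n, the linear part contracts by 1 - c/(n+1), and the net drift is c
- δ. -/
lemma tendsto_rpow_smul_sub_of_seminorm {E : Type*} [NormedAddCommGroup E] [NormedSpace ℝ E]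
    {H : E → E} {D : E →L[ℝ] E} {xs l : E} (hH : HasFDerivAt H D xs) (hH0 : H xs = 0)
    {p : Seminorm ℝ E} {K ε₀ c δ : ℝ} (hK : 0 < K) (hε₀ : 0 < ε₀) (hp1 : ∀ v, ‖v‖ ≤ p v)
    (hp2 : ∀ v, p v ≤ K * ‖v‖)
    (hp3 : ∀ t, 0 ≤ t → t ≤ ε₀ → ∀ v, p (v + t • D v) ≤ (1 - c * t) * p v)
    (hδ0 : 0 ≤ δ) (hδ1 : δ ≤ 1) (hδc : δ < c) {x U : ℕ → E}
    (hx : ∀ n : ℕ, x (n + 1) = x n + (1 / ((n : ℝ) + 1)) • (H (x n) + U n))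
    (hlim : Tendsto x atTop (𝓝 xs))
    (hU : Tendsto (fun n => ∑ k ∈ Finset.range n, ((k : ℝ) + 1) ^ (δ - 1) • U k) atTop (𝓝 l)) :
    Tendsto (fun n : ℕ => (n : ℝ) ^ δ • (x n - xs)) atTop (𝓝 0) := by
  set P : ℕ → E := fun n => ∑ k ∈ Finset.range n, ((k : ℝ) + 1) ^ (δ - 1) • U k with hP
  set T : ℕ → E := fun n => l - P n with hTdef
  have hT : Tendsto T atTop (𝓝 0) := by simpa using hU.const_sub l
  set W : ℕ → E := fun n => (n : ℝ) ^ δ • (x n - xs) + T n with hW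
  have hc : 0 < c := hδ0.trans_lt hδc
  suffices h : Tendsto (fun n => p (W n)) atTop (𝓝 0) by
    have h1 : Tendsto W atTop (𝓝 0) := squeeze_zero_norm (fun n => hp1 (W n)) h
    simpa [hW] using h1.sub hT
  refine tendsto_zero_of_recursion (fun n => apply_nonneg p _) (sub_pos.2 hδc) fun ε hε => ?_
  set η : ℝ := ε / (4 * K) with hη
  have hη0 : 0 < η := by positivity
  have hηK : 2 * K * η = ε / 2 := by rw [hη]; field_simp; ring
  have hR : ∀ᶠ n in atTop, ‖H (x n) - D (x n - xs)‖ ≤ η * ‖x n - xs‖ := by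
    have h1 := (hH.isLittleO.comp_tendsto hlim).bound hη0
    filter_upwards [h1] with n hn
    simpa [hH0] using hn
  -- `C` collects the coefficients of ‖T n‖ in the error bounds `b2`, `b3` and `b4`.
  set C : ℝ := 2 * K + 2 * K * ‖D‖ + ε / 2 with hC
  have hC0 : 0 < C := by positivity
  have hTn : ∀ᶠ n in atTop, ‖T n‖ < ε / C :=
    (tendsto_order.1 (tendsto_zero_iff_norm_tendsto_zero.1 hT)).2 _ (by positivity)
  have hγ : ∀ᶠ n : ℕ in atTop, 1 / ((n : ℝ) + 1) < min ε₀ (1 / c) :=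
    (tendsto_order.1 tendsto_one_div_add_atTop_nhds_zero_nat).2 _ (lt_min hε₀ (by positivity))
  have hn' : ∀ᶠ n : ℕ in atTop, δ / (n : ℝ) < ε / 2 :=
    (tendsto_order.1 (tendsto_const_div_atTop_nhds_zero_nat δ)).2 _ (by positivity)
  filter_upwards [hR, hTn, hγ, hn', eventually_ge_atTop 1] with n hRn hTn hγn hδn hn1
  have hn0 : (0 : ℝ) < n := by exact_mod_cast hn1
  set g : ℝ := 1 / ((n : ℝ) + 1) with hg
  have hg0 : 0 < g := by positivity
  have hginv : 1 / (n : ℝ) = g + g * (1 / n) := by rw [hg]; field_simp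
  have hg2 : 1 / (n : ℝ) ≤ 2 * g := by
    have : 1 / (n : ℝ) ≤ 1 := by
      rw [div_le_one hn0]; exact_mod_cast hn1
    nlinarith
  set z : ℝ := (n : ℝ) ^ δ with hz
  set z' : ℝ := ((n : ℝ) + 1) ^ δ with hz'
  have hzpos : 0 < z := Real.rpow_pos_of_pos hn0 δ
  have hz'pos : 0 < z' := Real.rpow_pos_of_pos (by positivity) δ
  set ζ : ℝ := z' / z with hζ
  have hζz : ζ * z = z' := div_mul_cancel₀ _ hzpos.ne'
  have hζ1 : 1 ≤ ζ := by
    rw [hζ, one_le_div hzpos]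
    exact Real.rpow_le_rpow hn0.le (by linarith) hδ0
  have hζδ : ζ ≤ 1 + δ * (1 / n) := by
    rw [hζ, div_le_iff₀ hzpos, mul_one_div]
    exact rpow_succ_le hδ0 hδ1 hn1
  have hn11 : 1 / (n : ℝ) ≤ 1 := by rw [div_le_one hn0]; exact_mod_cast hn1
  have hninv0 : 0 < 1 / (n : ℝ) := by positivity
  have hζ2 : ζ ≤ 2 := by nlinarith
  have hζg : ζ - 1 ≤ 2 * g := by nlinarith
  set e : E := x n - xs with he
  set R : E := H (x n) - D e with hRdef
  -- The noise `U n` has cancelled; the price is two terms in `T n`, besides the linearisation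
  -- remainder `R`.
  have hWn : W (n + 1) = ζ • (W n + g • D (W n)) - (ζ - 1) • T n - (ζ * g) • D (T n)
      + (z' * g) • R := by
    have e1 : x (n + 1) - xs = e + g • (D e + R + U n) := by
      have : D e + R = H (x n) := by rw [hRdef]; abel
      rw [this, hx n, he]; abel
    have e2 : T (n + 1) = T n - (z' * g) • U n := by
      simp only [hTdef, hP, Finset.sum_range_succ]
      rw [rpow_sub_one_eq, hg, mul_one_div, ← hz']
      abel
    have e3 : W n = z • e + T n := rfl
    have e4 : W (n + 1) = z' • (e + g • (D e + R + U n)) + (T n - (z' * g) • U n) := by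
      rw [← e1, ← e2, hz']
      simp only [hW]
      push_cast
      rfl
    rw [e4, e3, map_add, map_smul, ← hζz]
    module
  have hcg : 0 ≤ 1 - c * g := by
    have := (hγn.trans_le (min_le_right _ _)).le
    rw [le_div_iff₀ hc] at this
    linarith
  have hYW : z * ‖e‖ ≤ p (W n) + ‖T n‖ := by
    have : z • e = W n - T n := by simp [hW, hz, he]
    rw [← Real.norm_of_nonneg hzpos.le, ← norm_smul, this]
    exact (norm_sub_le _ _).trans (by linarith [hp1 (W n)])
  set w := p (W n) with hw
  have hw0 : 0 ≤ w := apply_nonneg p _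
  have hT0 := norm_nonneg (T n)
  have b1 : p (ζ • (W n + g • D (W n))) ≤ (1 - (c - δ) * g + g * (δ * (1 / n))) * w := by
    rw [map_smul_eq_mul, Real.norm_of_nonneg (by linarith)]
    have h1 := hp3 g hg0.le (hγn.trans_le (min_le_left _ _)).le (W n)
    have h2 : ζ * (1 - c * g) ≤ 1 - (c - δ) * g + g * (δ * (1 / n)) := by
      have h3 : ζ * (1 - c * g) ≤ (1 + δ * (1 / n)) * (1 - c * g) :=
        mul_le_mul_of_nonneg_right hζδ hcg
      have h4 : 0 ≤ δ * (1 / (n : ℝ)) * (c * g) := by positivity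
      have h5 : δ * (1 / (n : ℝ)) = δ * g + g * (δ * (1 / n)) := by
        linear_combination δ * hginv
      linarith
    calc ζ * p (W n + g • D (W n)) ≤ ζ * ((1 - c * g) * w) :=
          mul_le_mul_of_nonneg_left h1 (by linarith)
      _ = ζ * (1 - c * g) * w := by ring
      _ ≤ _ := mul_le_mul_of_nonneg_right h2 hw0
  have b2 : p ((ζ - 1) • T n) ≤ g * (2 * K * ‖T n‖) := by
    rw [map_smul_eq_mul, Real.norm_of_nonneg (by linarith)]
    calc (ζ - 1) * p (T n) ≤ (2 * g) * (K * ‖T n‖) :=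
          mul_le_mul hζg (hp2 _) (apply_nonneg p _) (by positivity)
      _ = _ := by ring
  have b3 : p ((ζ * g) • D (T n)) ≤ g * (2 * K * ‖D‖ * ‖T n‖) := by
    rw [map_smul_eq_mul, Real.norm_of_nonneg (by positivity)]
    calc (ζ * g) * p (D (T n)) ≤ (2 * g) * (K * (‖D‖ * ‖T n‖)) := by
          refine mul_le_mul (mul_le_mul_of_nonneg_right hζ2 hg0.le) ((hp2 _).trans ?_)
            (apply_nonneg p _) (by positivity)
          exact mul_le_mul_of_nonneg_left (D.le_opNorm _) hK.le
      _ = _ := by ring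
  have b4 : p ((z' * g) • R) ≤ g * (ε / 2 * (w + ‖T n‖)) := by
    rw [map_smul_eq_mul, Real.norm_of_nonneg (by positivity), ← hζz]
    calc ζ * z * g * p R ≤ 2 * z * g * (K * (η * ‖e‖)) := by
          refine mul_le_mul ?_ ((hp2 _).trans (mul_le_mul_of_nonneg_left hRn hK.le))
            (apply_nonneg p _) (by positivity)
          gcongr
      _ = g * (2 * K * η * (z * ‖e‖)) := by ring
      _ ≤ g * (ε / 2 * (w + ‖T n‖)) := by
          rw [hηK]; gcongr
  have b5 : p (W (n + 1)) ≤ p (ζ • (W n + g • D (W n))) + p ((ζ - 1) • T n)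
      + p ((ζ * g) • D (T n)) + p ((z' * g) • R) := by
    rw [hWn]
    refine (map_add_le_add p _ _).trans (add_le_add ?_ le_rfl)
    refine (map_sub_le_add p _ _).trans (add_le_add ?_ le_rfl)
    exact map_sub_le_add p _ _
  have b6 : C * ‖T n‖ ≤ ε := by
    have := mul_le_mul_of_nonneg_left hTn.le hC0.le
    rwa [mul_div_cancel₀ _ hC0.ne'] at this
  have b7 : g * (δ * (1 / n)) * w ≤ g * (ε / 2 * w) := by
    rw [mul_assoc, mul_one_div]; gcongr
  have b8 : g * (C * ‖T n‖) ≤ g * ε := mul_le_mul_of_nonneg_left b6 hg0.le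
  have b9 : (1 - (c - δ) / ((n : ℝ) + 1)) * w + ε * (w + 1) / ((n : ℝ) + 1)
      = (1 - (c - δ) * g) * w + g * (ε / 2 * w) + g * (ε / 2 * w) + g * ε := by
    rw [hg]; ring
  rw [b9]
  rw [hC] at b8
  linarith

variable {A : Type*} [Fintype A] [DecidableEq A] {S : A → Type*} [∀ i, Fintype (S i)]
  [∀ i, DecidableEq (S i)] [∀ i, Nonempty (S i)]

/-! ### Global convergence of the process of Cominetti et al. -/

/-- Up to the noise tail, each coordinate moves by a convex combination towards its expected payoff,
whose distance to the fixed point is at most L times the current one. Boundedness keeps the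
combination weights above c/(n+1), so the sup norm has drift c(1 - L). -/
lemma tendsto_of_noise_convergent [Nonempty A] (G : A → Profile S → ℝ) (β : A → ℝ)
    (hβ : ∀ i, 0 < β i) (hL : eta G * alpha β < 1) {xs l : State S}
    (hxs : logitPayoff G β xs = xs) {x U : ℕ → State S} {K : ℝ} (hK : ∀ n i r, |x n i r| ≤ K)
    (hx : ∀ n : ℕ, x (n + 1) = x n + (1 / ((n : ℝ) + 1)) • (Phi G β (x n) + U n))
    (hU : Tendsto (fun n => ∑ k ∈ Finset.range n, (1 / ((k : ℝ) + 1)) • U k) atTop (𝓝 l)) :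
    Tendsto x atTop (𝓝 xs) := by
  set P : ℕ → State S := fun n => ∑ k ∈ Finset.range n, (1 / ((k : ℝ) + 1)) • U k with hP
  set T : ℕ → State S := fun n => l - P n with hTdef
  have hT : Tendsto T atTop (𝓝 0) := by simpa using hU.const_sub l
  set L := eta G * alpha β with hLdef
  have hL0 : 0 ≤ L := mul_nonneg (eta_nonneg G) (alpha_nonneg β hβ)
  obtain ⟨c, hc0, hc⟩ : ∃ c > 0, ∀ n i r, c ≤ logit β (x n) i r := by
    choose c hc0 hc using fun i => exists_logit_ge (S := S) β hβ i K
    refine ⟨Finset.univ.inf' Finset.univ_nonempty c, (Finset.lt_inf'_iff _).2 fun i _ => hc0 i,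
      fun n i r => (Finset.inf'_le _ (Finset.mem_univ i)).trans (hc i _ (hK n i) r)⟩
  set W : ℕ → State S := fun n => x n - xs + T n with hW
  suffices h : Tendsto (fun n => ‖W n‖) atTop (𝓝 0) by
    have h1 : Tendsto W atTop (𝓝 0) := tendsto_zero_iff_norm_tendsto_zero.2 h
    have h2 := (h1.sub hT).add_const xs
    simpa [hW] using h2
  refine tendsto_zero_of_recursion (fun n => norm_nonneg _) (κ := c * (1 - L))
    (mul_pos hc0 (by linarith)) fun ε hε => ?_
  have hTn : ∀ᶠ n in atTop, ‖T n‖ < ε / 2 :=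
    (tendsto_order.1 (tendsto_zero_iff_norm_tendsto_zero.1 hT)).2 _ (by positivity)
  filter_upwards [hTn] with n hTn
  set g : ℝ := 1 / ((n : ℝ) + 1) with hg
  have hg0 : 0 < g := by positivity
  have hg1 : g ≤ 1 := by
    rw [hg, div_le_one (by positivity)]
    linarith [(Nat.cast_nonneg n : (0 : ℝ) ≤ n)]
  have hWn : W (n + 1) = W n + g • Phi G β (x n) := by
    simp only [hW, hTdef, hP, Finset.sum_range_succ, hx n]
    module
  have hw0 := norm_nonneg (W n)
  have hgoal : ∀ i r, |W (n + 1) i r| ≤ (1 - c * (1 - L) * g) * ‖W n‖ + g * ε := by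
    intro i r
    set σ := logit β (x n) i r with hσ
    have hσ0 : 0 < σ := logit_pos β _ i r
    have hσ1 : σ ≤ 1 := logit_le_one β _ i r
    have hcσ : c ≤ σ := hc n i r
    set f := logitPayoff G β (x n) i r - logitPayoff G β xs i r with hf
    have hxsir : logitPayoff G β xs i r = xs i r := by rw [hxs]
    have hfb : |f| ≤ L * (‖W n‖ + ‖T n‖) := by
      refine (abs_logitPayoff_sub_le G β hβ (x n) xs i r).trans
        (mul_le_mul_of_nonneg_left ?_ hL0)
      have : x n - xs = W n - T n := by simp [hW]
      rw [this]
      exact norm_sub_le _ _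
    have e1 : W (n + 1) i r = (1 - g * σ) * W n i r + g * σ * (f + T n i r) := by
      have e2 : W n i r = x n i r - xs i r + T n i r := rfl
      rw [hWn, Pi.add_apply, Pi.add_apply, Pi.smul_apply, Pi.smul_apply, Phi_apply, smul_eq_mul,
        ← hσ, hf, hxsir, e2]
      ring
    have hgσ : 0 ≤ 1 - g * σ := by nlinarith
    have hWir := abs_apply_le_norm (W n) i r
    have hTir := abs_apply_le_norm (T n) i r
    have hT0 := norm_nonneg (T n)
    calc |W (n + 1) i r| ≤ (1 - g * σ) * ‖W n‖ + g * σ * (L * (‖W n‖ + ‖T n‖) + ‖T n‖) := by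
          rw [e1]
          refine (abs_add_le _ _).trans (add_le_add ?_ ?_)
          · rw [abs_mul, abs_of_nonneg hgσ]
            exact mul_le_mul_of_nonneg_left hWir hgσ
          · rw [abs_mul, abs_of_nonneg (by positivity : 0 ≤ g * σ)]
            exact mul_le_mul_of_nonneg_left
              ((abs_add_le _ _).trans (add_le_add hfb hTir)) (by positivity)
      _ = ‖W n‖ - (σ * (1 - L) * g) * ‖W n‖ + g * (σ * ((L + 1) * ‖T n‖)) := by ring
      _ ≤ ‖W n‖ - (c * (1 - L) * g) * ‖W n‖ + g * ε := by
          have h1 : c * (1 - L) * g * ‖W n‖ ≤ σ * (1 - L) * g * ‖W n‖ := by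
            have : 0 ≤ 1 - L := by linarith
            gcongr
          have h2 : σ * ((L + 1) * ‖T n‖) ≤ ε := by
            calc σ * ((L + 1) * ‖T n‖) ≤ 1 * (2 * ‖T n‖) := by
                  refine mul_le_mul hσ1 ?_ (by positivity) zero_le_one
                  exact mul_le_mul_of_nonneg_right (by linarith) hT0
              _ ≤ ε := by linarith
          have h3 := mul_le_mul_of_nonneg_left h2 hg0.le
          linarith
      _ = _ := by ring
  have hnn : 0 ≤ (1 - c * (1 - L) * g) * ‖W n‖ + g * ε := by
    obtain ⟨i⟩ := ‹Nonempty A›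
    exact (abs_nonneg _).trans (hgoal i (Classical.arbitrary _))
  have h1 : ‖W (n + 1)‖ ≤ (1 - c * (1 - L) * g) * ‖W n‖ + g * ε :=
    (pi_norm_le_iff_of_nonneg hnn).2 fun i => (pi_norm_le_iff_of_nonneg hnn).2 fun r => hgoal i r
  have h2 : (1 - c * (1 - L) / ((n : ℝ) + 1)) * ‖W n‖ + ε * (‖W n‖ + 1) / ((n : ℝ) + 1)
      = (1 - c * (1 - L) * g) * ‖W n‖ + g * ε + g * (ε * ‖W n‖) := by
    rw [hg]; ring
  rw [h2]
  have h3 : 0 ≤ g * (ε * ‖W n‖) := by positivity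
  linarith

end LearningGame

/-! ### Measurability along the history and bounds on payoffs -/

namespace LearningGame

variable {A : Type*} [Fintype A] [DecidableEq A] {S : A → Type*} [∀ i, Fintype (S i)]
  [∀ i, DecidableEq (S i)]

/-- A function of the profiles played up to time `n` is measurable with respect to the history. -/
lemma measurable_history_of_dependsOn {Ω E : Type*} [MeasurableSpace E] (G : A → Profile S → ℝ)
    (s : ℕ → Ω → Profile S) (n : ℕ) (f : (ℕ → Profile S) → E)
    (hf : ∀ u v : ℕ → Profile S, (∀ m, 1 ≤ m → m ≤ n → u m = v m) → f u = f v) :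
    Measurable[history G s n] fun ω => f fun m => s m ω := by
  intro t _
  have h : (fun ω => f fun m => s m ω) ⁻¹' t
      = ⋃ v ∈ {v : Finset.Icc 1 n → Profile S | ∃ u : ℕ → Profile S, f u ∈ t ∧
          ∀ m : Finset.Icc 1 n, u m = v m}, ⋂ m : Finset.Icc 1 n, {ω | s m ω = v m} := by
    ext ω
    simp only [Set.mem_preimage, Set.mem_iUnion, Set.mem_iInter, Set.mem_ofPred_eq, exists_prop]
    constructor
    · exact fun h => ⟨fun m => s m ω, ⟨_, h, fun _ => rfl⟩, fun _ => rfl⟩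
    · rintro ⟨v, ⟨u, hu, huv⟩, hv⟩
      rwa [hf _ u fun m h1 h2 => ?_]
      have hm : m ∈ Finset.Icc 1 n := Finset.mem_Icc.2 ⟨h1, h2⟩
      exact (hv ⟨m, hm⟩).trans (huv ⟨m, hm⟩).symm
  rw [h]
  refine MeasurableSet.biUnion (Set.to_countable _) fun v _ => MeasurableSet.iInter fun m => ?_
  exact measurableSet_history_eq (Finset.mem_Icc.1 m.2).1 (Finset.mem_Icc.1 m.2).2 _

/-- A common bound for all payoffs. -/
noncomputable def payoffBound (G : A → Profile S → ℝ) : ℝ := ∑ i, ∑ a, |G i a|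

lemma abs_le_payoffBound (G : A → Profile S → ℝ) (i : A) (a : Profile S) :
    |G i a| ≤ payoffBound G :=
  (Finset.single_le_sum (f := fun a => |G i a|) (fun _ _ => abs_nonneg _)
    (Finset.mem_univ a)).trans
    (Finset.single_le_sum (f := fun i => ∑ a, |G i a|)
      (fun _ _ => Finset.sum_nonneg fun _ _ => abs_nonneg _) (Finset.mem_univ i))

lemma payoffBound_nonneg (G : A → Profile S → ℝ) : 0 ≤ payoffBound G :=
  Finset.sum_nonneg fun _ _ => Finset.sum_nonneg fun _ _ => abs_nonneg _

/-! ### The process of Cominetti et al. -/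

lemma cmsProcess_dependsOn (G : A → Profile S → ℝ) (x0 : State S) (n : ℕ) :
    ∀ u v : ℕ → Profile S, (∀ m, 1 ≤ m → m ≤ n → u m = v m) →
      cmsProcess G x0 u n = cmsProcess G x0 v n := by
  induction n with
  | zero => exact fun u v _ => rfl
  | succ n ih =>
    intro u v h
    simp only [cmsProcess]
    rw [ih u v fun m h1 h2 => h m h1 (h2.trans n.le_succ), h (n + 1) (by omega) le_rfl]

lemma abs_cmsProcess_le (G : A → Profile S → ℝ) (x0 : State S) (s : ℕ → Profile S) (n : ℕ)
    (i : A) (r : S i) : |(cmsProcess G x0 s n i r)| ≤ ‖x0‖ + payoffBound G := by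
  induction n with
  | zero => exact (abs_apply_le_norm x0 i r).trans (by linarith [payoffBound_nonneg G])
  | succ n ih =>
    simp only [cmsProcess]
    split_ifs
    · set g : ℝ := 1 / ((n : ℝ) + 1) with hg
      have hg0 : 0 ≤ g := by positivity
      have hg1 : 0 ≤ 1 - g := by
        rw [hg, sub_nonneg, div_le_one (by positivity)]
        linarith [(Nat.cast_nonneg n : (0 : ℝ) ≤ n)]
      refine (abs_add_le _ _).trans ?_
      rw [abs_mul, abs_mul, abs_of_nonneg hg0, abs_of_nonneg hg1]
      have h1 := mul_le_mul_of_nonneg_left ih hg1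
      have h2 := mul_le_mul_of_nonneg_left ((abs_le_payoffBound G i (s (n + 1))).trans
        (by linarith [norm_nonneg x0] : payoffBound G ≤ ‖x0‖ + payoffBound G)) hg0
      linarith
    · exact ih

/-- The martingale part of the increments of the process of Cominetti et al. -/
noncomputable def cmsNoise (G : A → Profile S → ℝ) (β : A → ℝ) (x0 : State S) (s : ℕ → Profile S)
    (n : ℕ) : State S := fun i r =>
  (if s (n + 1) i = r then G i (s (n + 1)) - cmsProcess G x0 s n i r else 0)
    - Phi G β (cmsProcess G x0 s n) i r

lemma cmsProcess_succ (G : A → Profile S → ℝ) (β : A → ℝ) (x0 : State S) (s : ℕ → Profile S)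
    (n : ℕ) : cmsProcess G x0 s (n + 1) = cmsProcess G x0 s n + (1 / ((n : ℝ) + 1)) •
      (Phi G β (cmsProcess G x0 s n) + cmsNoise G β x0 s n) := by
  ext i r
  simp only [cmsProcess, cmsNoise, Pi.add_apply, Pi.smul_apply, smul_eq_mul]
  by_cases h : s (n + 1) i = r
  · rw [if_pos h.symm, if_pos h]; ring
  · rw [if_neg fun h' => h h'.symm, if_neg h]; ring

variable [∀ i, Nonempty (S i)]

/-- The conditional mean that centres the noise: with t the current perception it is `Phi`, and with
t the rest point it serves the adjusted process. -/
lemma sum_ite_sub_mul_prod_logit (G : A → Profile S → ℝ) (β : A → ℝ) (x : State S) (i : A)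
    (r : S i) (t : ℝ) :
    ∑ a : Profile S, (if a i = r then G i a - t else 0) * ∏ k, logit β x k (a k)
      = logit β x i r * (logitPayoff G β x i r - t) := by
  have h1 := mul_payoffAgainst G (logit β x) i r
  have h2 := sum_ite_mul_prod (sum_logit β x) i r
  rw [logitPayoff, mul_sub, h1]
  conv_rhs => rw [← h2, Finset.sum_mul, ← Finset.sum_sub_distrib]
  refine Finset.sum_congr rfl fun a _ => ?_
  split_ifs <;> ring

/-- In each coordinate the weights are payoff minus current perception on the event that the
strategy is played. They are predictable, and bounded by `abs_cmsProcess_le`. -/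
lemma ae_exists_tendsto_cmsNoise {Ω : Type*} [MeasurableSpace Ω] {μ : Measure Ω}
    [IsProbabilityMeasure μ] (G : A → Profile S → ℝ) (β : A → ℝ) (x0 : State S)
    {s : ℕ → Ω → Profile S}
    (h : IsPlay μ G β s fun n ω => cmsProcess G x0 (fun m => s m ω) n) {δ : ℝ} (hδ : δ < 1 / 2) :
    ∀ᵐ ω ∂μ, ∃ l, Tendsto (fun n => ∑ k ∈ Finset.range n, ((k : ℝ) + 1) ^ (δ - 1) •
      cmsNoise G β x0 (fun m => s m ω) k) atTop (𝓝 l) := by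
  have hx : ∀ n, Measurable[history G s n] fun ω => cmsProcess G x0 (fun m => s m ω) n :=
    fun n => measurable_history_of_dependsOn G s n (fun u => cmsProcess G x0 u n)
      (cmsProcess_dependsOn G x0 n)
  have hxi : ∀ n i r, Measurable[history G s n] fun ω => cmsProcess G x0 (fun m => s m ω) n i r :=
    fun n i r => measurable_history_of_dependsOn G s n (fun u => cmsProcess G x0 u n i r)
      fun u v huv => by rw [cmsProcess_dependsOn G x0 n u v huv]
  have key : ∀ i r, ∀ᵐ ω ∂μ, ∃ l, Tendsto (fun n => ∑ k ∈ Finset.range n, ((k : ℝ) + 1) ^ (δ - 1) *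
      cmsNoise G β x0 (fun m => s m ω) k i r) atTop (𝓝 l) := by
    intro i r
    have h1 := ae_exists_tendsto_noise h hx
      (c := fun n ω a => if a i = r then G i a - cmsProcess G x0 (fun m => s m ω) n i r else 0)
      (C := payoffBound G + (‖x0‖ + payoffBound G)) (fun n a => ?_) (fun n ω a => ?_) hδ
    · simpa only [sum_ite_sub_mul_prod_logit, cmsNoise, Phi_apply] using h1
    · split_ifs
      · exact ((hxi n i r).const_sub _).stronglyMeasurable
      · exact stronglyMeasurable_const
    · split_ifs
      · exact (abs_sub _ _).trans
          (add_le_add (abs_le_payoffBound G i a) (abs_cmsProcess_le G x0 _ n i r))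
      · rw [abs_zero]
        linarith [payoffBound_nonneg G, norm_nonneg x0]
  filter_upwards [ae_all_iff.2 fun i => ae_all_iff.2 fun r => key i r] with ω hω
  choose l hl using hω
  refine ⟨l, tendsto_pi_nhds.2 fun i => tendsto_pi_nhds.2 fun r => (hl i r).congr fun n => ?_⟩
  simp [Finset.sum_apply]

/-- The only profile always yields the payoff `xs`, and the first step has size 1, which erases
`x0`. This case is separate because the Jacobian is then minus the identity, so |ρ| = 1 exceeds the
noise limit 1/2. -/
lemma cmsProcess_of_subsingleton [∀ i, Subsingleton (S i)] (G : A → Profile S → ℝ) (β : A → ℝ)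
    {xs : State S} (hxs : logitPayoff G β xs = xs) (x0 : State S) (s : ℕ → Profile S) (n : ℕ) :
    cmsProcess G x0 s (n + 1) = xs := by
  have h1 : ∀ (i : A) (r : S i) (a : Profile S), xs i r = G i a := by
    intro i r a
    have h2 := mul_payoffAgainst G (logit β xs) i r
    have h3 : payoffAgainst G i r (logit β xs) = xs i r := congrFun (congrFun hxs i) r
    rw [Fintype.sum_subsingleton _ a, logit_of_subsingleton, h3, one_mul,
      if_pos (Subsingleton.elim _ _), Finset.prod_eq_one fun k _ => logit_of_subsingleton β xs k _]
      at h2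
    rw [h2, mul_one]
  have hstep : ∀ (n : ℕ) (i : A) (r : S i), cmsProcess G x0 s (n + 1) i r
      = (1 - 1 / ((n : ℝ) + 1)) * cmsProcess G x0 s n i r
        + 1 / ((n : ℝ) + 1) * G i (s (n + 1)) := fun n i r => if_pos (Subsingleton.elim _ _)
  induction n with
  | zero =>
    ext i r
    rw [hstep, h1 i r (s (0 + 1))]
    simp
  | succ n ih =>
    ext i r
    rw [hstep, ih, ← h1 i r (s (n + 1 + 1))]
    ring

/-- The complexification of a state, as a function on the index set of the Jacobian. -/
noncomputable def complexify : State S →ₗ[ℝ] ((Σ i, S i) → ℂ) where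
  toFun v q := (v q.1 q.2 : ℂ)
  map_add' v w := by ext q; simp
  map_smul' t v := by ext q; simp

lemma norm_complexify (v : State S) : ‖complexify v‖ = ‖v‖ := by
  refine le_antisymm ((pi_norm_le_iff_of_nonneg (norm_nonneg v)).2 fun q => ?_)
    ((pi_norm_le_iff_of_nonneg (norm_nonneg _)).2 fun i =>
      (pi_norm_le_iff_of_nonneg (norm_nonneg _)).2 fun r => ?_)
  · simpa [complexify] using abs_apply_le_norm v q.1 q.2
  · simpa [complexify] using norm_le_pi_norm (complexify v) ⟨i, r⟩

lemma complexify_fderiv (H : State S → State S) (x v : State S) :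
    complexify (fderiv ℝ H x v)
      = ((jacobian H x).map fun b : ℝ => (b : ℂ)).mulVec (complexify v) := by
  ext ⟨i, r⟩
  have h : fderiv ℝ H x v i r = ∑ q, jacobian H x ⟨i, r⟩ q * v q.1 q.2 := by
    conv_lhs => rw [← sum_smul_unitState v, map_sum]
    simp only [Finset.sum_apply, map_smul, Pi.smul_apply, smul_eq_mul, jacobian_apply, mul_comm]
  simp [complexify, h, Matrix.mulVec, dotProduct]

lemma tendsto_rpow_smul_zero_of_le {E : Type*} [NormedAddCommGroup E] [NormedSpace ℝ E]
    {x : ℕ → E} {δ δ' : ℝ} (hδ : δ ≤ δ')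
    (h : Tendsto (fun n : ℕ => (n : ℝ) ^ δ' • x n) atTop (𝓝 0)) :
    Tendsto (fun n : ℕ => (n : ℝ) ^ δ • x n) atTop (𝓝 0) := by
  rw [tendsto_zero_iff_norm_tendsto_zero] at h ⊢
  refine squeeze_zero' (Eventually.of_forall fun n => norm_nonneg _) ?_ h
  filter_upwards [eventually_ge_atTop 1] with n hn
  rw [norm_smul, norm_smul]
  refine mul_le_mul_of_nonneg_right ?_ (norm_nonneg _)
  rw [Real.norm_of_nonneg (by positivity), Real.norm_of_nonneg (by positivity)]
  exact Real.rpow_le_rpow_of_exponent_le (by exact_mod_cast hn) hδ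

/-- Almost sure rate of convergence of the process of Cominetti et al. -/
theorem ae_tendsto_cmsProcess [Nonempty A] {Ω : Type*} [MeasurableSpace Ω] {μ : Measure Ω}
    [IsProbabilityMeasure μ] (G : A → Profile S → ℝ) (β : A → ℝ) (hβ : ∀ i, 0 < β i)
    (hL : eta G * alpha β < 1) {xs : State S} (hxs : logitPayoff G β xs = xs)
    {s : ℕ → Ω → Profile S} {x0 : State S}
    (h : IsPlay μ G β s fun n ω => cmsProcess G x0 (fun m => s m ω) n) :
    ∀ᵐ ω ∂μ, ∀ δ ∈ Set.Ioo (0 : ℝ) |rho (jacobian (Phi G β) xs)|,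
      Tendsto (fun n : ℕ => (n : ℝ) ^ δ • (cmsProcess G x0 (fun m => s m ω) n - xs))
        atTop (𝓝 0) := by
  by_cases hS : ∀ i, Subsingleton (S i)
  · refine Eventually.of_forall fun ω δ _ => ?_
    refine tendsto_const_nhds.congr' ?_
    filter_upwards [eventually_ge_atTop 1] with n hn
    obtain ⟨k, rfl⟩ := Nat.exists_eq_add_of_le' hn
    rw [cmsProcess_of_subsingleton G β hxs, sub_self, smul_zero]
  rw [not_forall] at hS
  have hρ := rho_jacobian_neg G β hβ hL hxs
  have hρ' := neg_half_le_rho_jacobian G β hxs hS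
  set ρ := rho (jacobian (Phi G β) xs) with hρdef
  have : Nonempty (Σ i, S i) := by
    obtain ⟨i, -⟩ := hS
    exact ⟨⟨i, Classical.arbitrary _⟩⟩
  -- Rational exponents leave countably many null sets, so a single event of full measure serves
  -- every real δ.
  have hnoise : ∀ q : {q : ℚ // (q : ℝ) < 1 / 2}, ∀ᵐ ω ∂μ, ∃ l, Tendsto (fun n =>
      ∑ k ∈ Finset.range n, ((k : ℝ) + 1) ^ ((q : ℝ) - 1) •
        cmsNoise G β x0 (fun m => s m ω) k) atTop (𝓝 l) :=
    fun q => ae_exists_tendsto_cmsNoise G β x0 h q.2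
  filter_upwards [ae_all_iff.2 hnoise] with ω hω δ hδ
  rw [abs_of_neg hρ] at hδ
  have hlim : Tendsto (fun n => cmsProcess G x0 (fun m => s m ω) n) atTop (𝓝 xs) := by
    obtain ⟨l, hl⟩ := hω ⟨0, by norm_num⟩
    refine tendsto_of_noise_convergent G β hβ hL hxs
      (fun n i r => abs_cmsProcess_le G x0 (fun m => s m ω) n i r)
      (cmsProcess_succ G β x0 fun m => s m ω) (l := l) (hl.congr fun n => ?_)
    refine Finset.sum_congr rfl fun k _ => ?_
    rw [rpow_sub_one_eq]
    simp
  -- δ < q < c < |ρ| ≤ 1/2: `q` is the exponent for which the noise converges, `c` the contraction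
  -- rate of the adapted norm.
  obtain ⟨q, hδq, hqρ⟩ := exists_rat_btwn hδ.2
  obtain ⟨c, hqc, hcρ⟩ := exists_between hqρ
  obtain ⟨p, K, ε₀, hε₀, hp1, hp2, hp3⟩ := exists_adapted_seminorm
    ((jacobian (Phi G β) xs).map fun b : ℝ => (b : ℂ)) complexify norm_complexify
    (fderiv ℝ (Phi G β) xs : State S →ₗ[ℝ] State S) (complexify_fderiv (Phi G β) xs) (c := c)
    fun z hz => (re_le_rho _ hz).trans_lt (by linarith)
  obtain ⟨l, hl⟩ := hω ⟨q, by linarith⟩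
  refine tendsto_rpow_smul_zero_of_le hδq.le ?_
  exact tendsto_rpow_smul_sub_of_seminorm (K := max K 1) ((differentiable_Phi G β) xs).hasFDerivAt
    ((isRestPhi_iff G β xs).2 hxs) (by positivity) hε₀ hp1
    (fun v => (hp2 v).trans (mul_le_mul_of_nonneg_right (le_max_left _ _) (norm_nonneg v))) hp3
    (hδ.1.trans hδq).le (by linarith) hqc (cmsProcess_succ G β x0 fun m => s m ω) hlim hl

end LearningGame

namespace LearningGame

variable {A : Type*} [Fintype A] [DecidableEq A] {S : A → Type*} [∀ i, Fintype (S i)]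
  [∀ i, DecidableEq (S i)]

/-! ### Weighted averages driven by a contraction -/

/-- Let `e` be an average of terms `f` that are bounded by `L ‖e‖`, up to a perturbation `Q`. If the
weights decrease at least like `κ / n` and `δ < κ (1 - L)`, then `e` is `o(n ^ (-δ))`. -/
lemma tendsto_rpow_smul_of_average [Nonempty A] [∀ i, Nonempty (S i)]
    {e σ f Q ψ h : ℕ → State S} {c L δ κ : ℝ}
    (hc : 0 < c) (hL0 : 0 ≤ L) (hL1 : L ≤ 1) (hδ0 : 0 ≤ δ) (hδ1 : δ ≤ 1)
    (hδκ : δ < κ * (1 - L))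
    (hσ : ∀ n i r, c ≤ σ n i r) (hσ1 : ∀ n i r, σ n i r ≤ 1)
    (hψ : ∀ n i r, ψ n i r * e n i r = h n i r + Q n i r)
    (hh : ∀ n i r, h (n + 1) i r = h n i r + σ n i r * f n i r)
    (hf : ∀ n i r, |f n i r| ≤ L * ‖e n‖)
    (hψA : ∀ i r, Tendsto (fun n => (∑ m ∈ Finset.range n, σ m i r) / ψ n i r) atTop (𝓝 1))
    (hQ : ∀ i r, Tendsto (fun n : ℕ => (n : ℝ) ^ (δ - 1) * Q n i r) atTop (𝓝 0))
    (hκ : ∀ i r, ∀ᶠ n : ℕ in atTop,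
      κ * ∑ m ∈ Finset.range (n + 1), σ m i r ≤ σ n i r * ((n : ℝ) + 1)) :
    Tendsto (fun n : ℕ => (n : ℝ) ^ δ • e n) atTop (𝓝 0) := by
  set a : ℕ → State S := fun n i r => ∑ m ∈ Finset.range n, σ m i r with ha
  have hac : ∀ (n : ℕ) i r, c * n ≤ a n i r := fun n i r => by
    have := Finset.card_nsmul_le_sum (Finset.range n) (fun m => σ m i r) c fun m _ => hσ m i r
    rwa [Finset.card_range, nsmul_eq_mul, mul_comm] at this
  set H : ℕ → State S := fun n i r => h n i r / a n i r with hH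
  -- `H` is the exact weighted average. `e` differs from it by the factor a/ψ → 1 and the additive
  -- term Q/a, which is o(n^(-δ)) because a ≥ cn.
  have hE : ∀ ε > 0, ∀ᶠ n : ℕ in atTop,
      (n : ℝ) ^ δ * ‖e n‖ ≤ (1 + ε) * ((n : ℝ) ^ δ * ‖H n‖ + ε) := by
    intro ε hε
    have h1 : ∀ᶠ n in atTop, ∀ i r, |a n i r / ψ n i r - 1| < min ε (1 / 2) :=
      eventually_all.2 fun i => eventually_all.2 fun r => by
        have := ((hψA i r).sub_const 1).abs
        rw [sub_self, abs_zero] at this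
        exact (tendsto_order.1 this).2 _ (by positivity)
    have h2 : ∀ᶠ n : ℕ in atTop, ∀ i r, |(n : ℝ) ^ (δ - 1) * Q n i r| < c * ε :=
      eventually_all.2 fun i => eventually_all.2 fun r => by
        have := (hQ i r).abs
        rw [abs_zero] at this
        exact (tendsto_order.1 this).2 _ (by positivity)
    filter_upwards [h1, h2, eventually_ge_atTop 1] with n h1 h2 hn
    have hn0 : (0 : ℝ) < n := by exact_mod_cast hn
    have hz : (0 : ℝ) < (n : ℝ) ^ δ := Real.rpow_pos_of_pos hn0 δ
    have hnn : 0 ≤ (1 + ε) * ((n : ℝ) ^ δ * ‖H n‖ + ε) := by positivity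
    rw [← Real.norm_of_nonneg hz.le, ← norm_smul, Real.norm_of_nonneg hz.le]
    refine (pi_norm_le_iff_of_nonneg hnn).2 fun i => (pi_norm_le_iff_of_nonneg hnn).2 fun r => ?_
    have hapos : 0 < a n i r := (mul_pos hc hn0).trans_le (hac n i r)
    have hq := abs_lt.1 (h1 i r)
    have hq1 := min_le_left ε (1 / 2 : ℝ)
    have hq2 := min_le_right ε (1 / 2 : ℝ)
    set q := a n i r / ψ n i r with hqdef
    have hqpos : 0 < q := by linarith
    have hψ0 : ψ n i r ≠ 0 := by
      intro h0
      rw [hqdef, h0, div_zero] at hqpos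
      exact lt_irrefl _ hqpos
    have e1 : e n i r = q * (H n i r + Q n i r / a n i r) := by
      have h3 : e n i r = (h n i r + Q n i r) / ψ n i r := by
        rw [eq_div_iff hψ0, mul_comm]; exact hψ n i r
      rw [h3, hqdef, hH]
      field_simp
    have e2 : (n : ℝ) ^ δ * |Q n i r / a n i r| ≤ ε := by
      have h3 : (n : ℝ) ^ (δ - 1) = (n : ℝ) ^ δ / n := Real.rpow_sub_one hn0.ne' δ
      have h4 := (h2 i r).le
      rw [h3, abs_mul, abs_of_pos (div_pos hz hn0), div_mul_eq_mul_div, div_le_iff₀ hn0] at h4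
      rw [abs_div, abs_of_pos hapos, ← mul_div_assoc, div_le_iff₀ hapos]
      have := mul_le_mul_of_nonneg_left (hac n i r) hε.le
      linarith
    rw [Pi.smul_apply, Pi.smul_apply, smul_eq_mul, norm_mul, Real.norm_of_nonneg hz.le, e1,
      Real.norm_eq_abs, abs_mul, abs_of_pos hqpos]
    calc (n : ℝ) ^ δ * (q * |H n i r + Q n i r / a n i r|)
        ≤ (n : ℝ) ^ δ * (q * (‖H n‖ + |Q n i r / a n i r|)) := by
          gcongr
          exact (abs_add_le _ _).trans (add_le_add (abs_apply_le_norm _ i r) le_rfl)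
      _ = q * ((n : ℝ) ^ δ * ‖H n‖ + (n : ℝ) ^ δ * |Q n i r / a n i r|) := by ring
      _ ≤ (1 + ε) * ((n : ℝ) ^ δ * ‖H n‖ + ε) := by
          gcongr
          linarith
  have hlim : Tendsto (fun n : ℕ => (n : ℝ) ^ δ * ‖H n‖) atTop (𝓝 0) := by
    refine tendsto_zero_of_recursion (fun n => by positivity) (sub_pos.2 hδκ) fun ε hε => ?_
    set ε₁ : ℝ := min 1 (c * ε / 8) with hε₁
    have hε₁0 : 0 < ε₁ := by positivity
    have hε₁1 : ε₁ ≤ 1 := min_le_left _ _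
    have hε₁c : 4 * (ε₁ / c) ≤ ε / 2 := by
      rw [← mul_div_assoc, div_le_iff₀ hc]
      have : ε₁ ≤ c * ε / 8 := min_le_right _ _
      linarith
    have hδn : ∀ᶠ n : ℕ in atTop, δ / (n : ℝ) < ε / 2 :=
      (tendsto_order.1 (tendsto_const_div_atTop_nhds_zero_nat δ)).2 _ (by positivity)
    filter_upwards [hE ε₁ hε₁0, hδn, eventually_ge_atTop 1,
      eventually_all.2 fun i => eventually_all.2 fun r => hκ i r] with n hEn hδn hn hκn
    have hn0 : (0 : ℝ) < n := by exact_mod_cast hn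
    set g : ℝ := 1 / ((n : ℝ) + 1) with hg
    have hg0 : 0 < g := by positivity
    have hginv : 1 / (n : ℝ) = g + g * (1 / n) := by rw [hg]; field_simp
    have hn11 : 1 / (n : ℝ) ≤ 1 := by rw [div_le_one hn0]; exact_mod_cast hn
    have hninv0 : 0 < 1 / (n : ℝ) := by positivity
    set z : ℝ := (n : ℝ) ^ δ with hz
    set z' : ℝ := ((n : ℝ) + 1) ^ δ with hz'
    have hzpos : 0 < z := Real.rpow_pos_of_pos hn0 δ
    have hz'pos : 0 < z' := Real.rpow_pos_of_pos (by positivity) δ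
    have hzz' : z' ≤ (1 + δ * (1 / n)) * z := by
      rw [mul_one_div]; exact rpow_succ_le hδ0 hδ1 hn
    have hζ2 : 1 + δ * (1 / (n : ℝ)) ≤ 2 := by nlinarith
    set w := z * ‖H n‖ with hw
    have hw0 : 0 ≤ w := by positivity
    set bound := (1 - (κ * (1 - L) - δ) * g + g * (δ * (1 / n))) * w
      + g * (4 * (ε₁ / c)) * (w + 1) with hbound
    have hgoal : ∀ i r, z' * |H (n + 1) i r| ≤ bound := by
      intro i r
      have hapos : 0 < a n i r := (mul_pos hc hn0).trans_le (hac n i r)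
      have ha' : a (n + 1) i r = a n i r + σ n i r := by
        simp only [ha, Finset.sum_range_succ]
      have hσ0 : 0 < σ n i r := hc.trans_le (hσ n i r)
      have ha'pos : 0 < a (n + 1) i r := by rw [ha']; positivity
      -- The share of the newest term in the average: τ ≥ κ/(n+1) supplies the drift κ(1 - L), and τ
      -- ≤ 1/(c(n+1)) controls the errors.
      set τ := σ n i r / a (n + 1) i r with hτ
      have hτ0 : 0 < τ := div_pos hσ0 ha'pos
      have hτ1 : τ ≤ 1 := (div_le_one ha'pos).2 (by rw [ha']; linarith)
      have hτκ : κ * g ≤ τ := by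
        rw [hτ, hg, mul_one_div, div_le_div_iff₀ (by positivity) ha'pos]
        exact hκn i r
      have e1 : H (n + 1) i r = (1 - τ) * H n i r + τ * f n i r := by
        have h1 : H (n + 1) i r = (h n i r + σ n i r * f n i r) / a (n + 1) i r := by
          rw [← hh]
        have h2 : h n i r = H n i r * a n i r := (div_mul_cancel₀ _ hapos.ne').symm
        rw [h1, h2, hτ, ha']
        rw [ha'] at ha'pos
        field_simp
        ring
      have h1 : |H (n + 1) i r| ≤ (1 - τ) * ‖H n‖ + τ * (L * ‖e n‖) := by
        rw [e1]
        refine (abs_add_le _ _).trans (add_le_add ?_ ?_)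
        · rw [abs_mul, abs_of_nonneg (sub_nonneg.2 hτ1)]
          exact mul_le_mul_of_nonneg_left (abs_apply_le_norm _ i r) (sub_nonneg.2 hτ1)
        · rw [abs_mul, abs_of_pos hτ0]
          exact mul_le_mul_of_nonneg_left (hf n i r) hτ0.le
      have h2 : z * ((1 - τ) * ‖H n‖ + τ * (L * ‖e n‖))
          ≤ (1 - τ * (1 - L)) * w + τ * (2 * ε₁ * (w + 1)) := by
        have h3 : L * (z * ‖e n‖) ≤ L * ((1 + ε₁) * (w + ε₁)) :=
          mul_le_mul_of_nonneg_left hEn hL0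
        have h4 : L * ((1 + ε₁) * (w + ε₁)) ≤ L * w + 2 * ε₁ * (w + 1) := by
          have h5 : L * (ε₁ * (w + 1) + ε₁ * ε₁) ≤ 1 * (ε₁ * (w + 1) + ε₁ * (w + 1)) := by
            refine mul_le_mul hL1 ?_ (by positivity) zero_le_one
            have : ε₁ * ε₁ ≤ ε₁ * (w + 1) := by
              refine mul_le_mul_of_nonneg_left ?_ hε₁0.le
              linarith
            linarith
          linarith
        have h5 := mul_le_mul_of_nonneg_left (h3.trans h4) hτ0.le
        have h6 : z * ((1 - τ) * ‖H n‖ + τ * (L * ‖e n‖))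
            = (1 - τ) * w + τ * (L * (z * ‖e n‖)) := by rw [hw]; ring
        rw [h6]
        linarith
      have hτc : τ ≤ g / c := by
        rw [hτ, hg, div_div]
        refine div_le_div₀ zero_le_one (hσ1 n i r) (by positivity) ?_
        have := hac (n + 1) i r
        push_cast at this
        linarith
      have hk : 0 ≤ κ * (1 - L) := hδ0.trans hδκ.le
      have h3 : (1 + δ * (1 / n)) * (1 - τ * (1 - L))
          ≤ 1 - (κ * (1 - L) - δ) * g + g * (δ * (1 / n)) := by
        have h4 : κ * g * (1 - L) ≤ τ * (1 - L) :=
          mul_le_mul_of_nonneg_right hτκ (sub_nonneg.2 hL1)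
        have h5 : (1 + δ * (1 / n)) * (1 - τ * (1 - L))
            ≤ (1 + δ * (1 / n)) * (1 - κ * g * (1 - L)) :=
          mul_le_mul_of_nonneg_left (by linarith) (by positivity)
        have h6 : 0 ≤ δ * (1 / (n : ℝ)) * (κ * (1 - L) * g) := by positivity
        have h7 : δ * (1 / (n : ℝ)) = δ * g + g * (δ * (1 / n)) := by
          linear_combination δ * hginv
        linarith
      have h4 : (1 + δ * (1 / (n : ℝ))) * (τ * (2 * ε₁ * (w + 1)))
          ≤ g * (4 * (ε₁ / c)) * (w + 1) := by
        calc (1 + δ * (1 / (n : ℝ))) * (τ * (2 * ε₁ * (w + 1)))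
            ≤ 2 * (g / c * (2 * ε₁ * (w + 1))) := by gcongr
          _ = _ := by ring
      calc z' * |H (n + 1) i r|
          ≤ ((1 + δ * (1 / n)) * z) * ((1 - τ) * ‖H n‖ + τ * (L * ‖e n‖)) :=
            mul_le_mul hzz' h1 (abs_nonneg _) (by positivity)
        _ = (1 + δ * (1 / n)) * (z * ((1 - τ) * ‖H n‖ + τ * (L * ‖e n‖))) := by ring
        _ ≤ (1 + δ * (1 / n)) * ((1 - τ * (1 - L)) * w + τ * (2 * ε₁ * (w + 1))) :=
            mul_le_mul_of_nonneg_left h2 (by positivity)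
        _ = (1 + δ * (1 / n)) * (1 - τ * (1 - L)) * w
            + (1 + δ * (1 / n)) * (τ * (2 * ε₁ * (w + 1))) := by ring
        _ ≤ bound := add_le_add (mul_le_mul_of_nonneg_right h3 hw0) h4
    have hb0 : 0 ≤ bound := by
      obtain ⟨i⟩ := ‹Nonempty A›
      exact (by positivity : 0 ≤ z' * |H (n + 1) i (Classical.arbitrary _)|).trans (hgoal i _)
    have h1 : z' * ‖H (n + 1)‖ ≤ bound := by
      rw [← Real.norm_of_nonneg hz'pos.le, ← norm_smul]
      refine (pi_norm_le_iff_of_nonneg hb0).2 fun i =>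
        (pi_norm_le_iff_of_nonneg hb0).2 fun r => ?_
      rw [Pi.smul_apply, Pi.smul_apply, norm_smul, Real.norm_of_nonneg hz'pos.le]
      exact hgoal i r
    push_cast
    refine h1.trans ?_
    have h2 : g * (δ * (1 / n)) * w ≤ g * (ε / 2) * (w + 1) := by
      rw [mul_one_div]
      gcongr
      linarith
    have h3 : g * (4 * (ε₁ / c)) * (w + 1) ≤ g * (ε / 2) * (w + 1) := by gcongr
    have h4 : (1 - (κ * (1 - L) - δ) / ((n : ℝ) + 1)) * w + ε * (w + 1) / ((n : ℝ) + 1)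
        = (1 - (κ * (1 - L) - δ) * g) * w + g * (ε / 2) * (w + 1) + g * (ε / 2) * (w + 1) := by
      rw [hg]; ring
    rw [h4, hbound]
    linarith
  rw [tendsto_zero_iff_norm_tendsto_zero, Metric.tendsto_nhds]
  intro ε hε
  have hε₁0 : 0 < min 1 (ε / 8) := by positivity
  filter_upwards [hE _ hε₁0, (tendsto_order.1 hlim).2 (ε / 8) (by positivity)] with n h1 h2
  have h3 : min 1 (ε / 8) ≤ 1 := min_le_left _ _
  have h4 : min 1 (ε / 8) ≤ ε / 8 := min_le_right _ _
  have hz : 0 ≤ (n : ℝ) ^ δ := by positivity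
  rw [Real.dist_eq, sub_zero, abs_of_nonneg (norm_nonneg _), norm_smul, Real.norm_of_nonneg hz]
  refine h1.trans_lt ?_
  have h5 : 0 ≤ (n : ℝ) ^ δ * ‖H n‖ := by positivity
  calc (1 + min 1 (ε / 8)) * ((n : ℝ) ^ δ * ‖H n‖ + min 1 (ε / 8))
      ≤ 2 * (ε / 8 + ε / 8) := by
        refine mul_le_mul (by linarith) (by linarith) (by positivity) (by norm_num)
    _ < ε := by linarith

end LearningGame

namespace LearningGame

variable {A : Type*} [Fintype A] [DecidableEq A] {S : A → Type*} [∀ i, Fintype (S i)]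
  [∀ i, DecidableEq (S i)]

/-! ### The adjusted process -/

lemma count_dependsOn (θ0 : State S) (n : ℕ) (u v : ℕ → Profile S)
    (h : ∀ m, 1 ≤ m → m ≤ n → u m = v m) : count θ0 u n = count θ0 v n := by
  ext i r
  simp only [count]
  congr 3
  refine Finset.filter_congr fun m hm => ?_
  rw [h m (Finset.mem_Icc.1 hm).1 (Finset.mem_Icc.1 hm).2]

lemma apProcess_dependsOn (G : A → Profile S → ℝ) (x0 θ0 : State S) (n : ℕ) :
    ∀ u v : ℕ → Profile S, (∀ m, 1 ≤ m → m ≤ n → u m = v m) →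
      apProcess G x0 θ0 u n = apProcess G x0 θ0 v n := by
  induction n with
  | zero => exact fun u v _ => rfl
  | succ n ih =>
    intro u v h
    have h' : ∀ m, 1 ≤ m → m ≤ n → u m = v m := fun m h1 h2 => h m h1 (h2.trans n.le_succ)
    simp only [apProcess]
    rw [ih u v h', count_dependsOn θ0 n u v h', h (n + 1) (by omega) le_rfl]

lemma count_succ (θ0 : State S) (s : ℕ → Profile S) (n : ℕ) (i : A) (r : S i) :
    count θ0 s (n + 1) i r = count θ0 s n i r + if s (n + 1) i = r then 1 else 0 := by
  simp only [count, Finset.card_filter]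
  rw [Finset.sum_Icc_succ_top (by omega)]
  push_cast
  ring

lemma count_eq (θ0 : State S) (s : ℕ → Profile S) (n : ℕ) (i : A) (r : S i) :
    count θ0 s n i r = θ0 i r + ∑ m ∈ Finset.range n, if s (m + 1) i = r then (1 : ℝ) else 0 := by
  induction n with
  | zero => simp [count]
  | succ n ih => rw [count_succ, ih, Finset.sum_range_succ, add_assoc]

lemma count_pos {θ0 : State S} (hθ0 : ∀ i r, 0 < θ0 i r) (s : ℕ → Profile S) (n : ℕ) (i : A)
    (r : S i) : 0 < count θ0 s n i r :=
  add_pos_of_pos_of_nonneg (hθ0 i r) (Nat.cast_nonneg _)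

/-- The perceptions in the adjusted process are averages of the payoffs received. -/
lemma count_sub_one_mul_apProcess_sub (G : A → Profile S → ℝ) (x0 : State S) {θ0 : State S}
    (hθ0 : ∀ i r, 0 < θ0 i r) (s : ℕ → Profile S) (i : A) (r : S i) (t : ℝ) (n : ℕ) :
    (count θ0 s n i r - 1) * (apProcess G x0 θ0 s n i r - t) = (θ0 i r - 1) * (x0 i r - t)
      + ∑ m ∈ Finset.range n, if s (m + 1) i = r then G i (s (m + 1)) - t else 0 := by
  induction n with
  | zero => simp [count, apProcess]
  | succ n ih =>
    have hpos := count_pos hθ0 s n i r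
    rw [Finset.sum_range_succ, ← add_assoc, ← ih, count_succ]
    simp only [apProcess]
    -- When `r` is played the count grows by one, so the new count minus 1 is the old count, the
    -- denominator of the update; this explains the shift by 1.
    by_cases h : s (n + 1) i = r
    · rw [if_pos h, if_pos h, if_pos h.symm]
      field_simp
      ring
    · rw [if_neg h, if_neg h, if_neg fun h' => h h'.symm]
      ring

/-- If θ0 < 1, the first use of a strategy has a step larger than 1 and is not an average. From then
on the count is at least 1 and each update is a convex combination, so one exceptional step suffices
in the bound. -/
lemma exists_abs_apProcess_le (G : A → Profile S → ℝ) (x0 : State S) {θ0 : State S}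
    (hθ0 : ∀ i r, 0 < θ0 i r) (s : ℕ → Profile S) :
    ∃ K, ∀ n i r, |(apProcess G x0 θ0 s n i r)| ≤ K := by
  have key : ∀ i r, ∃ K, ∀ n, |(apProcess G x0 θ0 s n i r)| ≤ K := by
    intro i r
    set g := payoffBound G with hg
    have hg0 : 0 ≤ g := payoffBound_nonneg G
    set M := |1 - 1 / θ0 i r| * |x0 i r| + 1 / θ0 i r * g + g with hM
    have hθ := hθ0 i r
    have hgM : g ≤ M := le_add_of_nonneg_left (by positivity)
    have h : ∀ n, (count θ0 s n i r = θ0 i r ∧ apProcess G x0 θ0 s n i r = x0 i r) ∨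
        (1 ≤ count θ0 s n i r ∧ |(apProcess G x0 θ0 s n i r)| ≤ M) := by
      intro n
      induction n with
      | zero => exact Or.inl ⟨by simp [count], rfl⟩
      | succ n ih =>
        have hG := abs_le_payoffBound G i (s (n + 1))
        rw [count_succ]
        simp only [apProcess]
        by_cases hs : s (n + 1) i = r
        · rw [if_pos hs, if_pos hs.symm]
          right
          refine ⟨by linarith [count_pos hθ0 s n i r], (abs_add_le _ _).trans ?_⟩
          rcases ih with ⟨h1, h2⟩ | ⟨h1, h2⟩
          · rw [h1, h2, abs_mul, abs_mul, abs_of_pos (one_div_pos.2 hθ)]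
            have := mul_le_mul_of_nonneg_left hG (one_div_pos.2 hθ).le
            linarith
          · set q := 1 / count θ0 s n i r with hq
            have hq0 : 0 ≤ q := by positivity
            have hq1 : 0 ≤ 1 - q := by
              rw [hq, sub_nonneg, div_le_one (by linarith)]; exact h1
            rw [abs_mul, abs_mul, abs_of_nonneg hq0, abs_of_nonneg hq1]
            have h3 := mul_le_mul_of_nonneg_left h2 hq1
            have h4 := mul_le_mul_of_nonneg_left (hG.trans hgM) hq0
            linarith
        · rw [if_neg hs, if_neg fun h' => hs h'.symm, add_zero]
          exact ih
    refine ⟨max |x0 i r| M, fun n => ?_⟩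
    rcases h n with ⟨-, h2⟩ | ⟨-, h2⟩
    · rw [h2]; exact le_max_left _ _
    · exact h2.trans (le_max_right _ _)
  choose K hK using key
  refine ⟨∑ i, ∑ r, |K i r|, fun n i r => (hK i r n).trans ((le_abs_self _).trans ?_)⟩
  exact (Finset.single_le_sum (f := fun r => |K i r|) (fun _ _ => abs_nonneg _)
    (Finset.mem_univ r)).trans
    (Finset.single_le_sum (f := fun i => ∑ r, |K i r|)
      (fun _ _ => Finset.sum_nonneg fun _ _ => abs_nonneg _) (Finset.mem_univ i))

variable [∀ i, Nonempty (S i)]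

/-- Noise of the counts of play. -/
noncomputable def playNoise (β : A → ℝ) (x : State S) (a : Profile S) (i : A) (r : S i) : ℝ :=
  (if a i = r then 1 else 0) - logit β x i r

/-- Noise of the payoffs, measured relative to the level `t`. -/
noncomputable def payoffNoise (G : A → Profile S → ℝ) (β : A → ℝ) (x : State S) (a : Profile S)
    (i : A) (r : S i) (t : ℝ) : ℝ :=
  (if a i = r then G i a - t else 0) - logit β x i r * (logitPayoff G β x i r - t)

/-- Payoffs are measured from the fixed level `xs i r` instead of the moving perception, so the
weights are deterministic. -/
lemma ae_exists_tendsto_apNoise {Ω : Type*} [MeasurableSpace Ω] {μ : Measure Ω}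
    [IsProbabilityMeasure μ] (G : A → Profile S → ℝ) (β : A → ℝ) (xs x0 θ0 : State S)
    {s : ℕ → Ω → Profile S}
    (h : IsPlay μ G β s fun n ω => apProcess G x0 θ0 (fun m => s m ω) n) {δ : ℝ}
    (hδ : δ < 1 / 2) :
    ∀ᵐ ω ∂μ, ∀ i r,
      (∃ l, Tendsto (fun n => ∑ k ∈ Finset.range n, ((k : ℝ) + 1) ^ (δ - 1) *
        playNoise β (apProcess G x0 θ0 (fun m => s m ω) k) (s (k + 1) ω) i r) atTop (𝓝 l)) ∧
      ∃ l, Tendsto (fun n => ∑ k ∈ Finset.range n, ((k : ℝ) + 1) ^ (δ - 1) *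
        payoffNoise G β (apProcess G x0 θ0 (fun m => s m ω) k) (s (k + 1) ω) i r (xs i r))
        atTop (𝓝 l) := by
  have hx : ∀ n, Measurable[history G s n] fun ω => apProcess G x0 θ0 (fun m => s m ω) n :=
    fun n => measurable_history_of_dependsOn G s n (fun u => apProcess G x0 θ0 u n)
      (apProcess_dependsOn G x0 θ0 n)
  refine ae_all_iff.2 fun i => ae_all_iff.2 fun r => ?_
  have h1 := ae_exists_tendsto_noise h hx (c := fun _ _ a => if a i = r then 1 else 0) (C := 1)
    (fun _ _ => stronglyMeasurable_const) (fun _ _ a => by split_ifs <;> simp) hδ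
  have h2 := ae_exists_tendsto_noise h hx
    (c := fun _ _ a => if a i = r then G i a - xs i r else 0)
    (C := payoffBound G + |xs i r|) (fun _ _ => stronglyMeasurable_const) (fun _ _ a => by
      split_ifs
      · exact (abs_sub _ _).trans (add_le_add (abs_le_payoffBound G i a) le_rfl)
      · rw [abs_zero]
        linarith [payoffBound_nonneg G, abs_nonneg (xs i r)]) hδ
  filter_upwards [h1, h2] with ω h1 h2
  refine ⟨?_, ?_⟩
  · simpa only [playNoise, sum_ite_mul_prod (sum_logit β _)] using h1
  · simpa only [payoffNoise, sum_ite_sub_mul_prod_logit] using h2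

/-- Convergence of the adjusted process along a path on which the noise is summable. -/
lemma tendsto_apProcess [Nonempty A] (G : A → Profile S → ℝ) (β : A → ℝ) (hβ : ∀ i, 0 < β i)
    (hL : 2 * (eta G * alpha β) < 1) {xs : State S} (hxs : logitPayoff G β xs = xs)
    (x0 : State S) {θ0 : State S} (hθ0 : ∀ i r, 0 < θ0 i r) (s : ℕ → Profile S)
    (hnoise : ∀ q : {q : ℚ // (q : ℝ) < 1 / 2}, ∀ i r,
      (∃ l, Tendsto (fun n => ∑ k ∈ Finset.range n, ((k : ℝ) + 1) ^ ((q : ℝ) - 1) *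
        playNoise β (apProcess G x0 θ0 s k) (s (k + 1)) i r) atTop (𝓝 l)) ∧
      ∃ l, Tendsto (fun n => ∑ k ∈ Finset.range n, ((k : ℝ) + 1) ^ ((q : ℝ) - 1) *
        payoffNoise G β (apProcess G x0 θ0 s k) (s (k + 1)) i r (xs i r)) atTop (𝓝 l))
    {δ : ℝ} (hδ : δ ∈ Set.Ioo (0 : ℝ) (1 / 2)) :
    Tendsto (fun n : ℕ => (n : ℝ) ^ δ •
      ((apProcess G x0 θ0 s n, freq θ0 s n) - (xs, logit β xs))) atTop (𝓝 0) := by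
  set L := eta G * alpha β with hLdef
  have hL0 : 0 ≤ L := mul_nonneg (eta_nonneg G) (alpha_nonneg β hβ)
  set x : ℕ → State S := fun n => apProcess G x0 θ0 s n with hx
  obtain ⟨K, hK⟩ := exists_abs_apProcess_le G x0 hθ0 s
  obtain ⟨c, hc0, hc⟩ : ∃ c > 0, ∀ n i r, c ≤ logit β (x n) i r := by
    choose c hc0 hc using fun i => exists_logit_ge (S := S) β hβ i K
    refine ⟨Finset.univ.inf' Finset.univ_nonempty c, (Finset.lt_inf'_iff _).2 fun i _ => hc0 i,
      fun n i r => (Finset.inf'_le _ (Finset.mem_univ i)).trans (hc i _ (hK n i) r)⟩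
  set σ : ℕ → State S := fun n => logit β (x n) with hσ
  set a : ℕ → State S := fun n i r => ∑ m ∈ Finset.range n, σ m i r with ha
  set Q' : ℕ → State S := fun n i r =>
    ∑ m ∈ Finset.range n, playNoise β (x m) (s (m + 1)) i r with hQ'
  set Q : ℕ → State S := fun n i r => (θ0 i r - 1) * (x0 i r - xs i r)
    + ∑ m ∈ Finset.range n, payoffNoise G β (x m) (s (m + 1)) i r (xs i r) with hQ
  set f : ℕ → State S := fun n i r => logitPayoff G β (x n) i r - xs i r with hf
  have hxsir : ∀ i r, logitPayoff G β xs i r = xs i r := fun i r => by rw [hxs]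
  have hcount : ∀ n i r, count θ0 s n i r = θ0 i r + a n i r + Q' n i r := by
    intro n i r
    rw [count_eq, add_assoc]
    simp only [ha, hQ', playNoise, ← Finset.sum_add_distrib, hσ]
    congr 1
    exact Finset.sum_congr rfl fun m _ => by ring
  have hac : ∀ (n : ℕ) i r, c * n ≤ a n i r := fun n i r => by
    have := Finset.card_nsmul_le_sum (Finset.range n) (fun m => σ m i r) c fun m _ => hc m i r
    rwa [Finset.card_range, nsmul_eq_mul, mul_comm] at this
  have hrpow : ∀ (t : ℝ) {δ : ℝ}, δ < 1 →
      Tendsto (fun n : ℕ => (n : ℝ) ^ (δ - 1) * t) atTop (𝓝 0) := by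
    intro t δ hδ
    rw [← zero_mul t]
    refine Tendsto.mul_const _ ?_
    have := (tendsto_rpow_neg_atTop (sub_pos.2 hδ)).comp tendsto_natCast_atTop_atTop
    simpa [Function.comp_def] using this
  have hQ'lim : ∀ q : ℚ, 0 ≤ (q : ℝ) → (q : ℝ) < 1 / 2 → ∀ i r,
      Tendsto (fun n : ℕ => (n : ℝ) ^ ((q : ℝ) - 1) * Q' n i r) atTop (𝓝 0) := by
    intro q hq0 hq1 i r
    obtain ⟨l, hl⟩ := (hnoise ⟨q, hq1⟩ i r).1
    exact tendsto_rpow_mul_sum_of_convergent hq0 (by linarith) hl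
  have hQlim : ∀ q : ℚ, 0 ≤ (q : ℝ) → (q : ℝ) < 1 / 2 → ∀ i r,
      Tendsto (fun n : ℕ => (n : ℝ) ^ ((q : ℝ) - 1) * Q n i r) atTop (𝓝 0) := by
    intro q hq0 hq1 i r
    obtain ⟨l, hl⟩ := (hnoise ⟨q, hq1⟩ i r).2
    have h1 := tendsto_rpow_mul_sum_of_convergent hq0 (by linarith) hl
    have h2 := (hrpow ((θ0 i r - 1) * (x0 i r - xs i r)) (by linarith : (q : ℝ) < 1)).add h1
    simpa only [hQ, mul_add, add_zero] using h2
  -- With exponent 0 the play noise is o(n), whereas the expected count `a` is at least cn.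
  have hψA : ∀ i r, Tendsto (fun n => a n i r / (count θ0 s n i r - 1)) atTop (𝓝 1) := by
    intro i r
    have h0 := hQ'lim 0 (by simp) (by norm_num) i r
    have h1 : Tendsto (fun n : ℕ => (n : ℝ)⁻¹ * (θ0 i r - 1 + Q' n i r)) atTop (𝓝 0) := by
      have := (hrpow (θ0 i r - 1) (by norm_num : (0 : ℝ) < 1)).add (by simpa using h0)
      simpa [mul_add, Real.rpow_neg_one] using this
    have h2 : Tendsto (fun n : ℕ => (θ0 i r - 1 + Q' n i r) / a n i r) atTop (𝓝 0) := by
      have h3 : Tendsto (fun n : ℕ => c⁻¹ * |(n : ℝ)⁻¹ * (θ0 i r - 1 + Q' n i r)|) atTop (𝓝 0) := by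
        simpa using h1.abs.const_mul c⁻¹
      refine squeeze_zero_norm' ?_ h3
      filter_upwards [eventually_ge_atTop 1] with n hn
      have hn0 : (0 : ℝ) < n := by exact_mod_cast hn
      have hap : 0 < a n i r := (mul_pos hc0 hn0).trans_le (hac n i r)
      rw [norm_div, Real.norm_eq_abs, Real.norm_of_nonneg hap.le, abs_mul,
        abs_of_pos (inv_pos.2 hn0), ← mul_assoc, ← mul_inv, ← div_eq_inv_mul]
      exact div_le_div_of_nonneg_left (abs_nonneg _) (mul_pos hc0 hn0) (hac n i r)
    have h3 : Tendsto (fun n : ℕ => (1 + (θ0 i r - 1 + Q' n i r) / a n i r)⁻¹) atTop (𝓝 1) := by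
      simpa using (h2.const_add 1).inv₀ (by norm_num)
    refine h3.congr' ?_
    filter_upwards [eventually_ge_atTop 1] with n hn
    have hn0 : (0 : ℝ) < n := by exact_mod_cast hn
    have hap : 0 < a n i r := (mul_pos hc0 hn0).trans_le (hac n i r)
    have h4 : count θ0 s n i r - 1 = a n i r * (1 + (θ0 i r - 1 + Q' n i r) / a n i r) := by
      rw [hcount]; field_simp; ring
    rw [h4, ← div_div, div_self hap.ne', one_div]
  have main : ∀ (q : ℚ) (κ : ℝ), 0 ≤ (q : ℝ) → (q : ℝ) < 1 / 2 → (q : ℝ) < κ * (1 - L) →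
      (∀ i r, ∀ᶠ n : ℕ in atTop, κ * a (n + 1) i r ≤ σ n i r * ((n : ℝ) + 1)) →
      Tendsto (fun n : ℕ => (n : ℝ) ^ (q : ℝ) • (x n - xs)) atTop (𝓝 0) := by
    intro q κ hq0 hq1 hqκ hκ
    refine tendsto_rpow_smul_of_average (e := fun n => x n - xs) (σ := σ) (f := f) (Q := Q)
      (ψ := fun n i r => count θ0 s n i r - 1)
      (h := fun n i r => ∑ m ∈ Finset.range n, σ m i r * f m i r)
      hc0 hL0 (by linarith) hq0 (by linarith) hqκ hc (fun n i r => logit_le_one β _ i r)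
      (fun n i r => ?_) (fun n i r => ?_) (fun n i r => ?_) hψA (hQlim q hq0 hq1) hκ
    · have h1 := count_sub_one_mul_apProcess_sub G x0 hθ0 s i r (xs i r) n
      rw [Pi.sub_apply, Pi.sub_apply, h1]
      simp only [hQ, payoffNoise]
      rw [add_left_comm, ← Finset.sum_add_distrib]
      congr 1
      exact Finset.sum_congr rfl fun m _ => by simp only [hσ, hf]; ring
    · exact Finset.sum_range_succ _ _
    · simp only [hf]
      rw [← hxsir i r]
      exact abs_logitPayoff_sub_le G β hβ (x n) xs i r
  -- First pass, without a rate: δ = 0 and the crude κ = c, valid since σ ≥ c and all weights are at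
  -- most 1.
  have hlim : Tendsto x atTop (𝓝 xs) := by
    have h1 := main 0 c (by simp) (by norm_num)
      (by simpa using mul_pos hc0 (by linarith)) fun i r => Eventually.of_forall fun n => by
        have h2 := Finset.sum_le_card_nsmul (Finset.range (n + 1)) (fun m => σ m i r) 1
          fun m _ => logit_le_one β _ i r
        rw [Finset.card_range, nsmul_eq_mul, mul_one] at h2
        push_cast at h2
        have h3 : 0 ≤ a (n + 1) i r := Finset.sum_nonneg fun m _ => (logit_pos β _ i r).le
        exact mul_le_mul (hc n i r) h2 h3 (logit_pos β _ i r).le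
    have h2 : Tendsto (fun n => x n - xs) atTop (𝓝 0) := by simpa using h1
    simpa using h2.add_const xs
  obtain ⟨q, hδq, hq⟩ := exists_rat_btwn hδ.2
  have hq0 : 0 < (q : ℝ) := hδ.1.trans hδq
  have hrate : Tendsto (fun n : ℕ => (n : ℝ) ^ (q : ℝ) • (x n - xs)) atTop (𝓝 0) := by
    -- Second pass: the weights and their Cesàro means now have the same positive limit, so every κ
    -- < 1 is admissible. For κ = 2q < 1 the condition q < κ(1 - L) reads 2L < 1.
    refine main q (2 * q) hq0.le hq (by nlinarith) fun i r => ?_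
    have h1 : Tendsto (fun n => σ n i r) atTop (𝓝 (logit β xs i r)) :=
      ((continuous_logit β i r).tendsto xs).comp hlim
    have h2 : Tendsto (fun n : ℕ => ((n + 1 : ℕ) : ℝ)⁻¹ * a (n + 1) i r) atTop
        (𝓝 (logit β xs i r)) := (h1.cesaro).comp (tendsto_add_atTop_nat 1)
    have h3 := (h1.sub (h2.const_mul (2 * (q : ℝ))))
    have h4 : 0 < logit β xs i r - 2 * q * logit β xs i r := by
      nlinarith [logit_pos β xs i r]
    filter_upwards [(tendsto_order.1 h3).1 0 h4] with n hn
    have hp : (0 : ℝ) < (n : ℝ) + 1 := by positivity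
    have h5 := mul_lt_mul_of_pos_right hn hp
    push_cast at h5
    rw [zero_mul, sub_mul, mul_assoc, mul_right_comm (((n : ℝ) + 1)⁻¹), inv_mul_cancel₀ hp.ne',
      one_mul] at h5
    linarith
  have hfreq : Tendsto (fun n : ℕ => (n : ℝ) ^ (q : ℝ) • (freq θ0 s n - logit β xs)) atTop
      (𝓝 0) := by
    refine tendsto_pi_nhds.2 fun i => tendsto_pi_nhds.2 fun r => ?_
    have h1 : Tendsto (fun n : ℕ => ((n : ℝ) + 1) ^ (q : ℝ) * (σ n i r - logit β xs i r)) atTop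
        (𝓝 0) := by
      have h2 : Tendsto (fun n : ℕ => 2 * β i * ‖(n : ℝ) ^ (q : ℝ) • (x n - xs)‖) atTop (𝓝 0) := by
        simpa using hrate.norm.const_mul (2 * β i)
      refine squeeze_zero_norm' ?_ h2
      filter_upwards [eventually_ge_atTop 1] with n hn
      have hn0 : (0 : ℝ) < n := by exact_mod_cast hn
      have hz : (0 : ℝ) < (n : ℝ) ^ (q : ℝ) := Real.rpow_pos_of_pos hn0 _
      have h3 : ((n : ℝ) + 1) ^ (q : ℝ) ≤ 2 * (n : ℝ) ^ (q : ℝ) := by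
        refine (rpow_succ_le hq0.le (by linarith) hn).trans
          (mul_le_mul_of_nonneg_right ?_ hz.le)
        have : (q : ℝ) / n ≤ 1 := by
          rw [div_le_one hn0]
          have : (1 : ℝ) ≤ n := by exact_mod_cast hn
          linarith
        linarith
      rw [norm_mul, Real.norm_of_nonneg (by positivity), norm_smul, Real.norm_of_nonneg hz.le]
      calc ((n : ℝ) + 1) ^ (q : ℝ) * ‖σ n i r - logit β xs i r‖
          ≤ (2 * (n : ℝ) ^ (q : ℝ)) * (β i * ‖x n - xs‖) :=
            mul_le_mul h3 (abs_logit_sub_le β hβ _ _ i r) (norm_nonneg _) (by positivity)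
        _ = _ := by ring
    have h2 := tendsto_rpow_mul_sum hq0.le (by linarith) h1
    -- The count minus (n+1)σ_* splits into a constant, the sum of the σ_k - σ_*, and the play
    -- noise. The constant contains -σ_* because `freq` divides by n + 1 while only n stages are
    -- summed.
    have h3 := ((hrpow (θ0 i r - logit β xs i r) (by linarith : (q : ℝ) < 1)).add h2).add
      (hQ'lim q hq0.le hq i r)
    have h4 : Tendsto (fun n : ℕ => (n : ℝ) / ((n : ℝ) + 1)) atTop (𝓝 1) :=
      tendsto_natCast_div_add_atTop (1 : ℝ)
    have h5 := h4.mul h3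
    simp only [add_zero, mul_zero] at h5
    refine h5.congr' ?_
    filter_upwards [eventually_ge_atTop 1] with n hn
    have hn0 : (0 : ℝ) < n := by exact_mod_cast hn
    have hp : (0 : ℝ) < (n : ℝ) + 1 := by positivity
    have h6 : ∑ k ∈ Finset.range n, (σ k i r - logit β xs i r)
        = a n i r - n * logit β xs i r := by
      rw [Finset.sum_sub_distrib, Finset.sum_const, Finset.card_range, nsmul_eq_mul]
    rw [Real.rpow_sub_one hn0.ne', h6, Pi.smul_apply, Pi.smul_apply, Pi.sub_apply, Pi.sub_apply,
      freq, hcount, smul_eq_mul]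
    field_simp
    ring
  refine tendsto_rpow_smul_zero_of_le hδq.le ?_
  exact hrate.prodMk_nhds hfreq

/-- Almost sure rate of convergence of the adjusted process. -/
theorem ae_tendsto_apProcess [Nonempty A] {Ω : Type*} [MeasurableSpace Ω] {μ : Measure Ω}
    [IsProbabilityMeasure μ] (G : A → Profile S → ℝ) (β : A → ℝ) (hβ : ∀ i, 0 < β i)
    (hL : 2 * (eta G * alpha β) < 1) {xs : State S} (hxs : logitPayoff G β xs = xs)
    {s : ℕ → Ω → Profile S} (x0 : State S) {θ0 : State S} (hθ0 : ∀ i r, 0 < θ0 i r)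
    (h : IsPlay μ G β s fun n ω => apProcess G x0 θ0 (fun m => s m ω) n) :
    ∀ᵐ ω ∂μ, ∀ δ ∈ Set.Ioo (0 : ℝ) (1 / 2),
      Tendsto (fun n : ℕ => (n : ℝ) ^ δ • ((apProcess G x0 θ0 (fun m => s m ω) n,
        freq θ0 (fun m => s m ω) n) - (xs, logit β xs))) atTop (𝓝 0) := by
  have hnoise := fun q : {q : ℚ // (q : ℝ) < 1 / 2} =>
    ae_exists_tendsto_apNoise G β xs x0 θ0 h q.2
  filter_upwards [ae_all_iff.2 hnoise] with ω hω δ hδ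
  exact tendsto_apProcess G β hβ hL hxs x0 hθ0 (fun m => s m ω) hω hδ

end LearningGame

theorem mainTheorem4 {A : Type*} [Fintype A] [DecidableEq A] [Nonempty A] {S : A → Type*}
    [∀ i, Fintype (S i)] [∀ i, DecidableEq (S i)] [∀ i, Nonempty (S i)]
    (G : A → LearningGame.Profile S → ℝ) (β : A → ℝ) (hβ : ∀ i, 0 < β i)
    (hηα : 2 * LearningGame.eta G * LearningGame.alpha β < 1) :
    ∃ xs ls : LearningGame.State S,
      (∀ x, LearningGame.IsRestPhi G β x ↔ x = xs) ∧
      (∀ x l, LearningGame.IsRestPsi G β x l ↔ x = xs ∧ l = ls) ∧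
      ∀ (Ω : Type*) [MeasurableSpace Ω] (μ : Measure Ω) [IsProbabilityMeasure μ]
        (s : ℕ → Ω → LearningGame.Profile S) (x0 : LearningGame.State S),
        (LearningGame.IsPlay μ G β s
            (fun n ω => LearningGame.cmsProcess G x0 (fun m => s m ω) n) →
          ∀ᵐ ω ∂μ, ∀ δ ∈ Set.Ioo (0 : ℝ)
              |LearningGame.rho (LearningGame.jacobian (LearningGame.Phi G β) xs)|,
            Tendsto (fun n : ℕ =>
                (n : ℝ) ^ δ • (LearningGame.cmsProcess G x0 (fun m => s m ω) n - xs))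
              atTop (𝓝 0)) ∧
        (∀ θ0 : LearningGame.State S, (∀ i r, 0 < θ0 i r) →
          LearningGame.IsPlay μ G β s
            (fun n ω => LearningGame.apProcess G x0 θ0 (fun m => s m ω) n) →
          ∀ᵐ ω ∂μ, ∀ δ ∈ Set.Ioo (0 : ℝ) (1 / 2),
            Tendsto (fun n : ℕ =>
                (n : ℝ) ^ δ • ((LearningGame.apProcess G x0 θ0 (fun m => s m ω) n,
                  LearningGame.freq θ0 (fun m => s m ω) n) - (xs, ls)))
              atTop (𝓝 0)) := by
  have hL0 : 0 ≤ LearningGame.eta G * LearningGame.alpha β :=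
    mul_nonneg (LearningGame.eta_nonneg G) (LearningGame.alpha_nonneg β hβ)
  have hL2 : 2 * (LearningGame.eta G * LearningGame.alpha β) < 1 := by rwa [← mul_assoc]
  have hL : LearningGame.eta G * LearningGame.alpha β < 1 := by linarith
  obtain ⟨xs, hxs, huniq⟩ := LearningGame.existsUnique_logitPayoff_eq G β hβ hL
  have hiff : ∀ x, LearningGame.logitPayoff G β x = x ↔ x = xs :=
    fun x => ⟨huniq x, fun h => h ▸ hxs⟩
  refine ⟨xs, LearningGame.logit β xs, fun x => ?_, fun x l => ?_, fun Ω _ μ _ s x0 =>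
    ⟨fun h => LearningGame.ae_tendsto_cmsProcess G β hβ hL hxs h,
      fun θ0 hθ0 h => LearningGame.ae_tendsto_apProcess G β hβ hL2 hxs x0 hθ0 h⟩⟩
  · rw [LearningGame.isRestPhi_iff, hiff]
  · rw [LearningGame.isRestPsi_iff, hiff]
    exact ⟨fun ⟨h1, h2⟩ => ⟨h1, h1 ▸ h2⟩, fun ⟨h1, h2⟩ => ⟨h1, h1 ▸ h2⟩⟩
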